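/- **Theorem 5.1.** Let $\delta_j\ge 1$ $(j\in\mathbf Z)$ be integers. A state of the generalized box-ball system with balls of $n$ colors $1<2<\dots<n$ and box capacities $\delta_j$ is an arrangement of finitely many balls (any number of each color) in boxes labeled by $j\in\mathbf Z$ such that the box $j$ holds at most $\delta_j$ balls; the order of the balls inside a box is irrelevant. One step of time evolution $s\mapsto s'$: every ball is moved exactly once; first the balls of color $1$ are moved, from the leftmost to the rightmost, each to the nearest box strictly to the right which is not full at that moment; then, in the same way, the balls of color $2,3,\dots,n$, in this order. The bi-word of a state $s$ is the two-rowed array with one column $\binom{j}{c}$ for every ball, of color $c$ in the box $j$, the columns being arranged in lexicographic order. Let $(P(s),Q(s))$ be the pair of tableaux of the same shape assigned to it by the Robinson–Schensted–Knuth correspondence: $P(s)$ is obtained by row bumping the bottom row from left to right into the empty tableau, and $Q(s)$ by writing, at each step, the top entry in the newly created box. The word $W(T)$ of a tableau $T$ is obtained by reading its rows from left to right, from the bottom row to the top row. The carrier algorithm with initial carrier $C$, a finite multiset, turns a word $w_1\cdots w_N$ into the word $w'_1\cdots w'_N$ as follows: put $C_0=C$; for $k=1,\dots,N$ let $w'_k$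 be the smallest element of $C_{k-1}$ larger than $w_k$ if there is one, and the minimum of $C_{k-1}$ otherwise, and let $C_k$ be obtained from $C_{k-1}$ by replacing one copy of $w'_k$ by $w_k$. Regard the box $j$ as a row of $\delta_j$ places, and number all the places of all the boxes from left to right by the integers $i\in\mathbf Z$; let $l_i$ be the label of the box to which the place $i$ belongs. In a state, let the balls of each box occupy its last places, so that its vacant places are packed to the left. Then the following hold. 1. The $P$-symbol is conserved: $P(s')=P(s)$ for every state $s$. 2. The $Q$-symbol evolves independently of the $P$-symbol: for given capacities $\delta_j$ there is a map $F$ such that $Q(s')=F(Q(s))$ for every state $s$, with any number $n$ of colors. 3. The evolution of the $Q$-symbol is given by the box-label algorithm with a carrier: let $s$ be a state with $N$ balls, and let $p,q$ be integers such that $p\le i$ and $i+N\le q$ for all places $i$ occupied in $s$ (for $N\ge1$ one may take $p$ to be the first occupied place and $q$ the last one plus $N$). Let $C$ be the multiset $\{l_i\mid p\le i\le q\}$ of box-labels, from which the entries of $Q(s)$ are removed, each as many times as it appears in $Q(s)$. Then $Q(s')$ has the same shape as $Q(s)$, and $W(Q(s'))$ is the word into which the carrier algorithm with initial carrier $C$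 turns $W(Q(s))$. -/

import Mathlib

namespace BoxBall

/-! ### Tableaux, bumping and the RSK correspondence -/

/-- A tableau is given by its rows, from top to bottom, each row read from left to right. -/
abbrev Tableau (α : Type*) := List (List α)

/-- Insert `x` into a row: if no entry of the row is larger than `x`, put `x` at the right end;
otherwise replace the leftmost entry larger than `x` by `x`.
The second component is the number that is bumped out, if any. -/
def rowInsert {α : Type*} [LinearOrder α] (x : α) : List α → List α × Option α
  | [] => ([x], none)
  | y :: r =>
    if x < y then (x :: r, some y)
    else (y :: (rowInsert x r).1, (rowInsert x r).2)

/-- Row bumping `T ← x`. The second component is the index (starting from `0` at the top) of the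
row at whose right end the new box appears. -/
def bump {α : Type*} [LinearOrder α] : Tableau α → α → Tableau α × ℕ
  | [], x => ([[x]], 0)
  | r :: T, x =>
    match rowInsert x r with
    | (r', none) => (r' :: T, 0)
    | (r', some y) => (r' :: (bump T y).1, (bump T y).2 + 1)

/-- Add a new box containing `i` at the right end of the row of index `k`
(which is a new row at the bottom if there is no such row). -/
def addBox {β : Type*} (i : β) : ℕ → Tableau β → Tableau β
  | _, [] => [[i]]
  | 0, r :: T => (r ++ [i]) :: T
  | k + 1, r :: T => r :: addBox i k T

/-- The RSK correspondence. A bi-word is given as the list of its columns `(i, j)`, from left to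
right, with `i` in the top row and `j` in the bottom row. The bottom row is bumped into the empty
tableau, which gives the `P`-symbol; at each step the top entry is recorded in the box that has
newly appeared, which gives the `Q`-symbol. -/
def rsk {β α : Type*} [LinearOrder α] (w : List (β × α)) : Tableau α × Tableau β :=
  w.foldl (fun PQ c => ((bump PQ.1 c.2).1, addBox c.1 (bump PQ.1 c.2).2 PQ.2)) ([], [])

/-- The word of a tableau: its entries read from left to right and bottom to top. -/
def readingWord {α : Type*} (T : Tableau α) : List α := T.reverse.flatten

/-- The shape of a tableau: the list of the lengths of its rows. -/
def shape {α : Type*} (T : Tableau α) : List ℕ := T.map List.length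

/-! ### The carrier algorithm -/

/-- The number unloaded from the carrier `C` (a weakly increasing sequence) when `x` is loaded: the
smallest number of `C` larger than `x` if there is one, and the minimum of `C` otherwise.
(For an empty carrier, which carries nothing to unload, the value is `x`.) -/
def unload {α : Type*} [LinearOrder α] (C : List α) (x : α) : α :=
  ((C.find? (fun c => x < c)).or C.head?).getD x

/-- The carrier after one step of loading and unloading: one copy of the unloaded number is
replaced by `x`, and the carrier is kept weakly increasing. -/
def reload {α : Type*} [LinearOrder α] (C : List α) (x : α) : List α :=
  (C.erase (unload C x)).orderedInsert (· ≤ ·) x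

/-- The carrier algorithm `(C, w) ↦ (C', w')`. -/
def carrierAlgorithm {α : Type*} [LinearOrder α] : List α → List α → List α × List α
  | C, [] => (C, [])
  | C, x :: w =>
    ((carrierAlgorithm (reload C x) w).1, unload C x :: (carrierAlgorithm (reload C x) w).2)

/-! ### The generalized box-ball system -/

/-- A state of the generalized box-ball system with balls of `n` colors and box capacities
`δ j ≥ 1`: finitely many balls are placed in the boxes, labeled by the integers, and the box `j`
holds at most `δ j` balls. The order of the balls inside a box is irrelevant. The colors, in
increasing order, are the elements of `Fin n`. -/
structure State (δ : ℤ → ℕ+) (n : ℕ) where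
  /-- the multiset of the colors of the balls in each box -/
  content : ℤ → Multiset (Fin n)
  /-- no box holds more balls than its capacity -/
  card_le : ∀ j, (content j).card ≤ (δ j : ℕ)
  /-- only finitely many boxes are not empty -/
  finite : {j | content j ≠ 0}.Finite

namespace State

variable {δ : ℤ → ℕ+} {n : ℕ}

/-- The labels of the boxes that are not empty. -/
noncomputable def nonemptyBoxes (s : State δ n) : Finset ℤ := s.finite.toFinset

/-- The total number of balls. -/
noncomputable def numBalls (s : State δ n) : ℕ := ∑ j ∈ s.nonemptyBoxes, (s.content j).card

/-- The nearest box strictly to the right of the box `i` that is not filled up. -/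
noncomputable def nearestRight (s : State δ n) (i : ℤ) : ℤ :=
  sInf {j : ℤ | i < j ∧ (s.content j).card < (δ j : ℕ)}

theorem nearestRight_mem (s : State δ n) (i : ℤ) :
    i < s.nearestRight i ∧ (s.content (s.nearestRight i)).card < (δ (s.nearestRight i) : ℕ) := by
  have hne : {j : ℤ | i < j ∧ (s.content j).card < (δ j : ℕ)}.Nonempty := by
    obtain ⟨j, hj, hij⟩ := ((Set.Ioi_infinite i).sdiff s.finite).nonempty.imp
      (fun j hj => ⟨hj.2, hj.1⟩ : ∀ j, j ∈ Set.Ioi i \ _ → (j ∉ _ ∧ j ∈ Set.Ioi i))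
    refine ⟨j, hij, ?_⟩
    have h0 : s.content j = 0 := by simpa using hj
    rw [h0]
    exact (δ j).pos
  exact Int.csInf_mem hne ⟨i, fun j hj => hj.1.le⟩

/-- Move one ball of color `k` from the box `i` to the nearest box to the right that is not
filled up. -/
noncomputable def moveBall (k : Fin n) (s : State δ n) (i : ℤ) : State δ n where
  content j :=
    if j = i then (s.content j).erase k
    else if j = s.nearestRight i then k ::ₘ s.content j
    else s.content j
  card_le j := by
    split_ifs with h1 h2
    · exact (Multiset.card_le_card (Multiset.erase_le _ _)).trans (s.card_le j)
    · rw [Multiset.card_cons, h2]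
      exact (s.nearestRight_mem i).2
    · exact s.card_le j
  finite := by
    refine (s.finite.union (Set.toFinite {i, s.nearestRight i})).subset ?_
    intro j hj
    by_cases h1 : j = i
    · simp [h1]
    by_cases h2 : j = s.nearestRight i
    · simp [h2]
    · left
      simpa [h1, h2] using hj

/-- The boxes containing the balls of color `k`, one entry for each such ball, from left to
right. -/
noncomputable def positions (s : State δ n) (k : Fin n) : List ℤ :=
  (s.nonemptyBoxes.sort (· ≤ ·)).flatMap fun i => List.replicate ((s.content i).count k) i

/-- Move all the balls of color `k`, each of them once, from the leftmost to the rightmost. -/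
noncomputable def moveColor (s : State δ n) (k : Fin n) : State δ n :=
  (s.positions k).foldl (moveBall k) s

/-- One step of time evolution: move the balls of the first color, then those of the second
color, and so on. -/
noncomputable def evolve (s : State δ n) : State δ n :=
  (List.finRange n).foldl moveColor s

/-- The bi-word of a state, as the list of its columns (box-label, ball-color): the boxes are
scanned from left to right, the balls of one box being arranged in increasing order of colors. -/
noncomputable def biword (s : State δ n) : List (ℤ × Fin n) :=
  (s.nonemptyBoxes.sort (· ≤ ·)).flatMap fun i =>
    ((s.content i).sort (· ≤ ·)).map fun c => (i, c)

/-- The `P`-symbol of a state. -/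
noncomputable def pSymbol (s : State δ n) : Tableau (Fin n) := (rsk s.biword).1

/-- The `Q`-symbol of a state. -/
noncomputable def qSymbol (s : State δ n) : Tableau ℤ := (rsk s.biword).2

end State

/-! ### The sequence of all box-labels

The box `j` is a row of `δ j` consecutive places. All the places of all the boxes are numbered from
left to right by the integers. -/

/-- The last place `d j` of the box `j`: here `d 0 = 0` and `d j - d (j - 1) = δ j`. -/
noncomputable def lastPlace (δ : ℤ → ℕ+) (j : ℤ) : ℤ :=
  ∑ i ∈ Finset.Ioc 0 j, ((δ i : ℕ) : ℤ) - ∑ i ∈ Finset.Ioc j 0, ((δ i : ℕ) : ℤ)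

/-- The label of the box to which the place `i` belongs, that is, the first `j` with
`i ≤ d j`. -/
noncomputable def boxLabel (δ : ℤ → ℕ+) (i : ℤ) : ℤ := sInf {j : ℤ | i ≤ lastPlace δ j}

/-- The place `i` is occupied by a ball, when the vacancies of each box are packed to the left
and its balls to the right. -/
def State.Occupied {δ : ℤ → ℕ+} {n : ℕ} (s : State δ n) (i : ℤ) : Prop :=
  lastPlace δ (boxLabel δ i) - (s.content (boxLabel δ i)).card < i

/-- The initial carrier of the box-label algorithm for a `Q`-symbol `Q`: the multiset of the
box-labels of all places in the interval `[p, q]`, from which the entries of `Q` are removed, each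
as many times as it appears in `Q`; it is arranged in weakly increasing order. -/
noncomputable def initialCarrier (δ : ℤ → ℕ+) (p q : ℤ) (Q : Tableau ℤ) : List ℤ :=
  ((Finset.Icc p q).val.map (boxLabel δ) - (readingWord Q : Multiset ℤ)).sort (· ≤ ·)

end BoxBall

namespace BoxBall

/-! List the box-labels of the balls color by color, increasingly within each color; call this word
`boxWord`. Exchanging the two rows of the bi-word exchanges the two symbols (`rsk_swap`), so Q(s) is
the insertion tableau of `boxWord` and P(s) is its recording tableau, the colors being recorded.

One step of evolution is the carrier algorithm applied to `boxWord`. The carrier stores the labels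
of the vacant places: a ball leaving box i takes the nearest vacancy to its right, which is the
unloaded number, and leaves a vacancy at i, which is the loaded one (`IsCarrier.evolve`). The window
[p, q] contains enough vacancies on the right for every unloaded number to exceed the loaded one.
Under this condition the algorithm is row insertion into the single row C, and its output is the
word bumped out of that row (`Loads.rowResult_bumped`).

Let w be a word and w' its carrier output. Inserting w into the one-row tableau with row C gives the
final carrier on top of the insertion tableau of w'. As w is plactic equivalent to the reading word
of its own insertion tableau T, the same result comes from inserting the reading word of T. The
carrier sends that reading word to the reading word of a semistandard tableau of the same shape
(`IsSemistandard.exists_carrierWord`), which must therefore be the insertion tableau of w'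
(`insertWord_carrierWord`).

For w = `boxWord` this is the box-label algorithm for Q. For all prefixes of `boxWord` it says that
the shapes of the successive insertion tableaux do not change; the numbers of balls of each color do
not change either, so the recording tableau P is conserved. Finally, the carrier depends on s only
through Q(s) and the window, and two states have a common window; hence Q(s) determines Q(s'). -/

theorem readingWord_cons {α : Type*} (r : List α) (T : Tableau α) :
    readingWord (r :: T) = readingWord T ++ r := by
  simp [readingWord]

/-! ### Row insertion -/

section Insertion

variable {α : Type*} [LinearOrder α]

theorem rowInsert_cons_of_lt {x y : α} (h : x < y) (r : List α) :
    rowInsert x (y :: r) = (x :: r, some y) := by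
  simp [rowInsert, h]

theorem rowInsert_cons_of_le {x y : α} (h : y ≤ x) (r : List α) :
    rowInsert x (y :: r) = (y :: (rowInsert x r).1, (rowInsert x r).2) := by
  simp [rowInsert, not_lt.mpr h]

/-- The row obtained by inserting successively the letters of a word. -/
def rowResult (r w : List α) : List α := w.foldl (fun r x => (rowInsert x r).1) r

/-- The numbers bumped out, if any, when the letters of a word are inserted successively. -/
def rowOut : List α → List α → List (Option α)
  | _, [] => []
  | r, x :: w => (rowInsert x r).2 :: rowOut (rowInsert x r).1 w

/-- The word of the numbers bumped out. -/
def bumped (r w : List α) : List α := (rowOut r w).reduceOption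

/-- The successive row bumping of the letters of a word into a tableau. -/
def insertWord (T : Tableau α) (w : List α) : Tableau α := w.foldl (fun T x => (bump T x).1) T

@[simp] theorem rowResult_nil (r : List α) : rowResult r [] = r := rfl
@[simp] theorem rowResult_cons (r w : List α) (x : α) :
    rowResult r (x :: w) = rowResult (rowInsert x r).1 w := rfl
@[simp] theorem rowOut_nil (r : List α) : rowOut r [] = [] := rfl
@[simp] theorem rowOut_cons (r w : List α) (x : α) :
    rowOut r (x :: w) = (rowInsert x r).2 :: rowOut (rowInsert x r).1 w := rfl
@[simp] theorem bumped_nil (r : List α) : bumped r [] = [] := rfl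
@[simp] theorem insertWord_nil (T : Tableau α) : insertWord T [] = T := rfl
@[simp] theorem insertWord_cons (T : Tableau α) (x : α) (w : List α) :
    insertWord T (x :: w) = insertWord (bump T x).1 w := rfl

theorem rowResult_append (r u v : List α) :
    rowResult r (u ++ v) = rowResult (rowResult r u) v := by
  simp [rowResult]

theorem rowOut_append (r u v : List α) :
    rowOut r (u ++ v) = rowOut r u ++ rowOut (rowResult r u) v := by
  induction u generalizing r with
  | nil => rfl
  | cons x u ih => simp [ih]

theorem insertWord_append (T : Tableau α) (u v : List α) :
    insertWord T (u ++ v) = insertWord (insertWord T u) v := by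
  simp [insertWord]

theorem bumped_cons (r w : List α) (x : α) :
    bumped r (x :: w) = (rowInsert x r).2.toList ++ bumped (rowInsert x r).1 w := by
  simp only [bumped, rowOut_cons]
  cases (rowInsert x r).2 <;> simp [List.reduceOption_cons_of_some, List.reduceOption_cons_of_none]

theorem bump_cons (r : List α) (T : Tableau α) (x : α) :
    (bump (r :: T) x).1 = (rowInsert x r).1 :: insertWord T (rowInsert x r).2.toList := by
  rcases h : rowInsert x r with ⟨r', _ | y⟩ <;> simp [bump, h]

/-- Lower rows see only what the first row bumps out, in the same order. This allows every statement
on tableaux to be proved row by row; with T empty it links the carrier, viewed as one row, with the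
insertion tableau of its output. -/
theorem insertWord_cons_row (r : List α) (T : Tableau α) (w : List α) :
    insertWord (r :: T) w = rowResult r w :: insertWord T (bumped r w) := by
  induction w generalizing r T with
  | nil => rfl
  | cons x w ih => simp [bump_cons, ih, bumped_cons, insertWord_append]

/-- Makes the row-by-row formula available below the last row. The empty word is excluded because it
would leave a spurious empty row. -/
theorem insertWord_nil_tableau {w : List α} (hw : w ≠ []) :
    insertWord [] w = insertWord [[]] w := by
  cases w with
  | nil => exact absurd rfl hw
  | cons x w => simp [bump, rowInsert]

theorem rowInsert_perm (x : α) (r : List α) :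
    ((rowInsert x r).2.toList ++ (rowInsert x r).1).Perm (x :: r) := by
  induction r with
  | nil => simp [rowInsert]
  | cons y r ih =>
    rcases lt_or_ge x y with h | h
    · simpa [rowInsert_cons_of_lt h] using List.Perm.swap x y r
    · rw [rowInsert_cons_of_le h]
      exact List.perm_middle.trans ((ih.cons y).trans (List.Perm.swap x y r))

theorem mem_rowInsert {x z : α} {r : List α} (h : z ∈ (rowInsert x r).1) : z = x ∨ z ∈ r := by
  have := (rowInsert_perm x r).subset (List.mem_append_right _ h)
  simpa using this

theorem lt_of_rowInsert_eq_some {x y : α} {r : List α} (h : (rowInsert x r).2 = some y) :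
    x < y := by
  induction r with
  | nil => simp [rowInsert] at h
  | cons z r ih =>
    rcases lt_or_ge x z with h' | h'
    · rw [rowInsert_cons_of_lt h'] at h
      simp only [Option.some.injEq] at h
      exact h ▸ h'
    · rw [rowInsert_cons_of_le h'] at h
      exact ih h

theorem mem_of_rowInsert_eq_some {x y : α} {r : List α} (h : (rowInsert x r).2 = some y) :
    y ∈ r := by
  induction r with
  | nil => simp [rowInsert] at h
  | cons z r ih =>
    rcases lt_or_ge x z with h' | h'
    · rw [rowInsert_cons_of_lt h'] at h
      simp only [Option.some.injEq] at h
      simp [h]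
    · rw [rowInsert_cons_of_le h'] at h
      exact List.mem_cons_of_mem _ (ih h)

theorem rowInsert_sorted {x : α} {r : List α} (hr : r.Pairwise (· ≤ ·)) :
    (rowInsert x r).1.Pairwise (· ≤ ·) := by
  induction r with
  | nil => simp [rowInsert]
  | cons y r ih =>
    rw [List.pairwise_cons] at hr
    rcases lt_or_ge x y with h | h
    · rw [rowInsert_cons_of_lt h, List.pairwise_cons]
      exact ⟨fun a ha => h.le.trans (hr.1 a ha), hr.2⟩
    · rw [rowInsert_cons_of_le h, List.pairwise_cons]
      refine ⟨fun a ha => ?_, ih hr.2⟩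
      rcases mem_rowInsert ha with rfl | ha
      · exact h
      · exact hr.1 a ha

theorem rowInsert_eq_of_forall_le {x : α} {r : List α} (h : ∀ a ∈ r, a ≤ x) :
    rowInsert x r = (r ++ [x], none) := by
  induction r with
  | nil => rfl
  | cons y r ih =>
    rw [rowInsert_cons_of_le (h y (by simp)), ih fun a ha => h a (by simp [ha])]
    rfl

theorem forall_le_of_rowInsert_eq_none {x : α} {r : List α} (h : (rowInsert x r).2 = none) :
    ∀ a ∈ r, a ≤ x := by
  induction r with
  | nil => simp
  | cons y r ih =>
    rcases lt_or_ge x y with h' | h'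
    · simp [rowInsert_cons_of_lt h'] at h
    · rw [rowInsert_cons_of_le h'] at h
      simpa [h'] using ih h

/-- If `r` is sorted, the number bumped out is at most any entry larger than the inserted one. -/
theorem exists_rowInsert_eq_some {x a : α} {r : List α} (hr : r.Pairwise (· ≤ ·)) (ha : a ∈ r)
    (hx : x < a) : ∃ y ≤ a, (rowInsert x r).2 = some y := by
  induction r with
  | nil => simp at ha
  | cons z r ih =>
    rw [List.pairwise_cons] at hr
    rcases lt_or_ge x z with h' | h'
    · refine ⟨z, ?_, by rw [rowInsert_cons_of_lt h']⟩
      rcases List.mem_cons.mp ha with rfl | ha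
      · exact le_rfl
      · exact hr.1 a ha
    · rw [rowInsert_cons_of_le h']
      rcases List.mem_cons.mp ha with rfl | ha
      · exact absurd hx (not_lt.mpr h')
      · exact ih hr.2 ha

theorem self_mem_rowInsert (x : α) (r : List α) : x ∈ (rowInsert x r).1 := by
  induction r with
  | nil => simp [rowInsert]
  | cons y r ih =>
    rcases lt_or_ge x y with h | h
    · simp [rowInsert_cons_of_lt h]
    · simp [rowInsert_cons_of_le h, ih]

/-- The numbers bumped out by two weakly increasing letters are weakly increasing. -/
theorem bumped_le {y z a b : α} {r : List α} (hr : r.Pairwise (· ≤ ·)) (hyz : y ≤ z)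
    (ha : (rowInsert y r).2 = some a) (hb : (rowInsert z (rowInsert y r).1).2 = some b) :
    a ≤ b := by
  have hzb := lt_of_rowInsert_eq_some hb
  rcases mem_rowInsert (mem_of_rowInsert_eq_some hb) with rfl | hbr
  · exact absurd hyz (not_le.mpr hzb)
  · obtain ⟨c, hc, hc'⟩ := exists_rowInsert_eq_some hr hbr (hyz.trans_lt hzb)
    rw [ha, Option.some.injEq] at hc'
    exact hc' ▸ hc

theorem rowInsert_none_of_none {y z : α} {r : List α} (hyz : y ≤ z)
    (ha : (rowInsert y r).2 = none) : (rowInsert z (rowInsert y r).1).2 = none := by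
  have h := forall_le_of_rowInsert_eq_none ha
  rw [rowInsert_eq_of_forall_le h, rowInsert_eq_of_forall_le]
  intro a ha
  rcases List.mem_append.mp ha with ha | ha
  · exact (h a ha).trans hyz
  · rw [List.mem_singleton.mp ha]
    exact hyz

/-- Letters not smaller than the first entry of a row leave that entry in its place. -/
theorem rowResult_cons_of_le {x : α} (r : List α) {w : List α} (h : ∀ a ∈ w, x ≤ a) :
    rowResult (x :: r) w = x :: rowResult r w := by
  induction w generalizing r with
  | nil => rfl
  | cons y w ih =>
    rw [rowResult_cons, rowInsert_cons_of_le (h y (by simp)), ih _ fun a ha => h a (by simp [ha])]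
    rfl

theorem rowOut_cons_of_le {x : α} (r : List α) {w : List α} (h : ∀ a ∈ w, x ≤ a) :
    rowOut (x :: r) w = rowOut r w := by
  induction w generalizing r with
  | nil => rfl
  | cons y w ih =>
    rw [rowOut_cons, rowInsert_cons_of_le (h y (by simp)), ih _ fun a ha => h a (by simp [ha])]
    rfl

/-! ### Knuth relations -/

/-- The elementary Knuth relations. -/
inductive KnuthStep : List α → List α → Prop
  | left {x y z : α} : x < y → y ≤ z → KnuthStep [y, z, x] [y, x, z]
  | right {x y z : α} : x ≤ y → y < z → KnuthStep [x, z, y] [z, x, y]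

/-- Induction on the row: a head not exceeding the smallest letter x is never touched, which leaves
only the cases where x meets a larger head h. There the letters y and z act in the same way in both
orders, and only the output caused by x changes its place. -/
theorem KnuthStep.row_left {x y z : α} (hxy : x < y) (hyz : y ≤ z) {r : List α}
    (hr : r.Pairwise (· ≤ ·)) :
    rowResult r [y, z, x] = rowResult r [y, x, z] ∧
      (bumped r [y, z, x] = bumped r [y, x, z] ∨
        KnuthStep (bumped r [y, z, x]) (bumped r [y, x, z])) := by
  induction r with
  | nil =>
    simp [rowInsert, bumped, hxy, not_lt.mpr hyz, not_lt.mpr (hxy.le.trans hyz)]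
  | cons h t ih =>
    rw [List.pairwise_cons] at hr
    obtain ⟨hh, ht⟩ := hr
    rcases lt_or_ge x h with h1 | h1
    · rcases lt_or_ge y h with h2 | h2
      · have e1 : rowInsert y (h :: t) = (y :: t, some h) := rowInsert_cons_of_lt h2 t
        have e2 := rowInsert_cons_of_le hyz t
        have e3 := rowInsert_cons_of_le (hxy.le.trans hyz) t
        have e4 := rowInsert_cons_of_lt hxy
        simp only [rowResult_cons, rowResult_nil, bumped_cons, e1, e2, e3, e4, true_and]
        rcases hz : (rowInsert z t).2 with _ | c
        · left; simp
        · right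
          exact KnuthStep.left h2 (hh c (mem_of_rowInsert_eq_some hz))
      · have e1 := rowInsert_cons_of_le h2
        have e2 := rowInsert_cons_of_le (h2.trans hyz)
        have e3 := rowInsert_cons_of_lt h1
        have e4 := rowInsert_cons_of_le (hxy.le.trans hyz)
        simp only [rowResult_cons, rowResult_nil, bumped_cons, e1, e2, e3, e4, true_and]
        rcases hy : (rowInsert y t).2 with _ | b
        · left
          simp [rowInsert_none_of_none hyz hy]
        · rcases hz : (rowInsert z (rowInsert y t).1).2 with _ | c
          · left; simp
          · right
            exact KnuthStep.left (h2.trans_lt (lt_of_rowInsert_eq_some hy)) (bumped_le ht hyz hy hz)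
    · have hle : ∀ a ∈ [y, z, x], h ≤ a := by
        simp [h1, h1.trans hxy.le, (h1.trans hxy.le).trans hyz]
      have hle' : ∀ a ∈ [y, x, z], h ≤ a := by
        simp [h1, h1.trans hxy.le, (h1.trans hxy.le).trans hyz]
      rw [rowResult_cons_of_le _ hle, rowResult_cons_of_le _ hle', bumped, bumped,
        rowOut_cons_of_le _ hle, rowOut_cons_of_le _ hle']
      exact ⟨congrArg _ (ih ht).1, (ih ht).2⟩

theorem KnuthStep.row_right {x y z : α} (hxy : x ≤ y) (hyz : y < z) {r : List α}
    (hr : r.Pairwise (· ≤ ·)) :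
    rowResult r [x, z, y] = rowResult r [z, x, y] ∧
      (bumped r [x, z, y] = bumped r [z, x, y] ∨
        KnuthStep (bumped r [x, z, y]) (bumped r [z, x, y])) := by
  induction r with
  | nil =>
    simp [rowInsert, bumped, hyz, not_lt.mpr hxy, hxy.trans_lt hyz,
      not_lt.mpr (hxy.trans_lt hyz).le, List.reduceOption]
  | cons h t ih =>
    rw [List.pairwise_cons] at hr
    obtain ⟨hh, ht⟩ := hr
    have hxz := hxy.trans_lt hyz
    rcases lt_or_ge x h with h1 | h1
    · rcases lt_or_ge z h with h2 | h2
      · have e1 := rowInsert_cons_of_lt h1 t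
        have e2 := rowInsert_cons_of_lt h2 t
        have e3 := rowInsert_cons_of_lt hxz t
        have e4 := rowInsert_cons_of_le hxz.le
        have e5 := rowInsert_cons_of_le hxy
        simp only [rowResult_cons, rowResult_nil, bumped_cons, e1, e2, e3, e4, e5]
        cases t with
        | nil => simp [rowInsert, hyz]
        | cons g t =>
          have hg := h2.trans_le (hh g (by simp))
          rw [rowInsert_cons_of_lt hg, rowInsert_cons_of_lt (hyz.trans hg)]
          simp only [rowInsert_cons_of_lt hyz, true_and]
          right
          -- The outputs are h, g, z and h, z, g with z < h ≤ g: here a relation of the second kind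
          -- comes out as one of the first kind.
          exact KnuthStep.left h2 (hh g (by simp))
      · have e1 := rowInsert_cons_of_lt h1
        have e2 := rowInsert_cons_of_le h2
        have e4 := rowInsert_cons_of_le hxz.le
        have e5 := rowInsert_cons_of_le hxy
        simp only [rowResult_cons, rowResult_nil, bumped_cons, e1, e2, e4, e5, true_and]
        rcases hz : (rowInsert z t).2 with _ | c
        · left; simp
        · right
          obtain ⟨b, hb, hb'⟩ := exists_rowInsert_eq_some (rowInsert_sorted ht)
            (self_mem_rowInsert z t) hyz
          rw [hb']
          refine KnuthStep.right ?_ (hb.trans_lt (lt_of_rowInsert_eq_some hz))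
          rcases mem_rowInsert (mem_of_rowInsert_eq_some hb') with rfl | hm
          · exact h2
          · exact hh b hm
    · have hle : ∀ a ∈ [x, z, y], h ≤ a := by
        simp [h1, h1.trans hxy, (h1.trans hxy).trans hyz.le]
      have hle' : ∀ a ∈ [z, x, y], h ≤ a := by
        simp [h1, h1.trans hxy, (h1.trans hxy).trans hyz.le]
      rw [rowResult_cons_of_le _ hle, rowResult_cons_of_le _ hle', bumped, bumped,
        rowOut_cons_of_le _ hle, rowOut_cons_of_le _ hle']
      exact ⟨congrArg _ (ih ht).1, (ih ht).2⟩

theorem KnuthStep.row {u v r : List α} (h : KnuthStep u v) (hr : r.Pairwise (· ≤ ·)) :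
    rowResult r u = rowResult r v ∧
      (bumped r u = bumped r v ∨ KnuthStep (bumped r u) (bumped r v)) := by
  cases h with
  | left h1 h2 => exact KnuthStep.row_left h1 h2 hr
  | right h1 h2 => exact KnuthStep.row_right h1 h2 hr

/-- All rows of the tableau are weakly increasing. -/
def RowsSorted (T : Tableau α) : Prop := ∀ r ∈ T, r.Pairwise (· ≤ ·)

theorem RowsSorted.bump {T : Tableau α} (hT : RowsSorted T) (x : α) :
    RowsSorted (BoxBall.bump T x).1 := by
  induction T generalizing x with
  | nil => simp [RowsSorted, BoxBall.bump]
  | cons r T ih =>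
    simp only [RowsSorted, List.forall_mem_cons] at hT
    rw [bump_cons, RowsSorted, List.forall_mem_cons]
    refine ⟨rowInsert_sorted hT.1, ?_⟩
    cases (rowInsert x r).2 with
    | none => exact hT.2
    | some y => exact ih hT.2 y

theorem RowsSorted.insertWord {T : Tableau α} (hT : RowsSorted T) (w : List α) :
    RowsSorted (BoxBall.insertWord T w) := by
  induction w generalizing T with
  | nil => exact hT
  | cons x w ih => exact ih (hT.bump x)

theorem rowsSorted_nil : RowsSorted ([] : Tableau α) := by simp [RowsSorted]

/-- Two words are plactic equivalent if row bumping them into any tableau gives the same result. -/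
def PlacticEq (u v : List α) : Prop :=
  ∀ T : Tableau α, RowsSorted T → insertWord T u = insertWord T v

theorem PlacticEq.trans {u v w : List α} (h : PlacticEq u v) (h' : PlacticEq v w) :
    PlacticEq u w := fun T hT => (h T hT).trans (h' T hT)

theorem PlacticEq.append_left {u v : List α} (h : PlacticEq u v) (a : List α) :
    PlacticEq (a ++ u) (a ++ v) := fun T hT => by
  rw [insertWord_append, insertWord_append, h _ (hT.insertWord a)]

theorem PlacticEq.append_right {u v : List α} (h : PlacticEq u v) (a : List α) :
    PlacticEq (u ++ a) (v ++ a) := fun T hT => by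
  rw [insertWord_append, insertWord_append, h _ hT]

/-- Each row absorbs both words with the same result and hands down words that are equal or again
form an elementary Knuth pair, so induction on the rows applies. -/
theorem KnuthStep.placticEq {u v : List α} (h : KnuthStep u v) : PlacticEq u v := by
  intro T hT
  induction T generalizing u v with
  | nil =>
    cases h with
    | left h1 h2 =>
      simp [BoxBall.bump, rowInsert, h1, not_lt.mpr h2, not_lt.mpr (h1.le.trans h2)]
    | right h1 h2 =>
      simp [BoxBall.bump, rowInsert, not_lt.mpr h1, h2, h1.trans_lt h2,
        not_lt.mpr (h1.trans_lt h2).le]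
  | cons r T ih =>
    simp only [RowsSorted, List.forall_mem_cons] at hT
    rw [insertWord_cons_row, insertWord_cons_row]
    obtain ⟨h1, h2⟩ := h.row hT.1
    rw [h1]
    rcases h2 with h2 | h2
    · rw [h2]
    · rw [ih h2 hT.2]

/-- The letter x travels to the left through t, one Knuth relation of the first kind for each letter
passed. -/
theorem placticEq_of_lt_head {x h : α} {t : List α} (ht : (h :: t).Pairwise (· ≤ ·))
    (hx : x < h) : PlacticEq (h :: t ++ [x]) (h :: x :: t) := by
  induction t generalizing h with
  | nil => exact fun T hT => rfl
  | cons g t ih =>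
    rw [List.pairwise_cons] at ht
    have hg : h ≤ g := ht.1 g (by simp)
    have h1 := (ih ht.2 (hx.trans_le hg)).append_left [h]
    have h2 := (KnuthStep.left hx hg).placticEq.append_right t
    exact h1.trans h2

theorem placticEq_rowInsert {x y : α} {r : List α} (hr : r.Pairwise (· ≤ ·))
    (h : (rowInsert x r).2 = some y) : PlacticEq (r ++ [x]) (y :: (rowInsert x r).1) := by
  induction r with
  | nil => simp [rowInsert] at h
  | cons a t ih =>
    rcases lt_or_ge x a with h1 | h1
    · rw [rowInsert_cons_of_lt h1] at h ⊢
      simp only [Option.some.injEq] at h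
      subst h
      exact placticEq_of_lt_head hr h1
    · rw [rowInsert_cons_of_le h1] at h ⊢
      rw [List.pairwise_cons] at hr
      refine ((ih hr.2 h).append_left [a]).trans ?_
      -- The bumped letter y now stands between a and the head g of the new tail. Since a ≤ g ≤ x <
      -- y, a relation of the second kind carries y past a.
      have key : ∃ g t', (rowInsert x t).1 = g :: t' ∧ a ≤ g ∧ g ≤ x := by
        cases t with
        | nil => simp [rowInsert] at h
        | cons b t =>
          rcases lt_or_ge x b with h2 | h2
          · exact ⟨x, t, by rw [rowInsert_cons_of_lt h2], h1, le_rfl⟩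
          · exact ⟨b, _, by rw [rowInsert_cons_of_le h2], hr.1 b (by simp), h2⟩
      obtain ⟨g, t', e, hag, hgx⟩ := key
      rw [e]
      exact (KnuthStep.right hag
        (hgx.trans_lt (lt_of_rowInsert_eq_some h))).placticEq.append_right t'

/-- Reading from the bottom up, the letter bumped out of the first row arrives just to the right of
the word of the remaining rows, where it is inserted next. -/
theorem placticEq_readingWord_bump {T : Tableau α} (hT : RowsSorted T) (x : α) :
    PlacticEq (readingWord T ++ [x]) (readingWord (bump T x).1) := by
  induction T generalizing x with
  | nil => exact fun T hT => rfl
  | cons r T ih =>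
    simp only [RowsSorted, List.forall_mem_cons] at hT
    rw [bump_cons, readingWord_cons, readingWord_cons]
    rcases h : (rowInsert x r).2 with _ | y
    · have h1 := rowInsert_eq_of_forall_le (forall_le_of_rowInsert_eq_none h)
      rw [h1]
      simp only [Option.toList_none, insertWord_nil, List.append_assoc]
      exact fun T hT => rfl
    · have h1 := (placticEq_rowInsert hT.1 h).append_left (readingWord T)
      have h2 := (ih hT.2 y).append_right (rowInsert x r).1
      simp only [List.append_assoc, List.singleton_append] at h1 h2 ⊢
      exact h1.trans h2

/-- A word is plactic equivalent to the word of its `P`-symbol. -/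
theorem placticEq_readingWord_insertWord (w : List α) :
    PlacticEq w (readingWord (insertWord [] w)) := by
  induction w using List.reverseRecOn with
  | nil => exact fun T hT => rfl
  | append_singleton w x ih =>
    rw [insertWord_append]
    exact (ih.append_right [x]).trans
      (placticEq_readingWord_bump (rowsSorted_nil.insertWord w) x)

/-! ### Semistandard tableaux -/

/-- The row `s`, placed below the row `r`, is not longer than `r` and has larger entries. -/
def ColumnLT : List α → List α → Prop
  | _, [] => True
  | [], _ :: _ => False
  | x :: r, y :: s => x < y ∧ ColumnLT r s

/-- Semistandard tableaux. -/
def IsSemistandard : Tableau α → Prop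
  | [] => True
  | r :: T => r ≠ [] ∧ r.Pairwise (· ≤ ·) ∧ ColumnLT r (T.headD []) ∧ IsSemistandard T

@[simp] theorem columnLT_nil (r : List α) : ColumnLT r [] := by cases r <;> trivial

@[simp] theorem columnLT_cons {x y : α} {r s : List α} :
    ColumnLT (x :: r) (y :: s) ↔ x < y ∧ ColumnLT r s := Iff.rfl

theorem ColumnLT.rowInsert {x : α} {r s : List α} (h : ColumnLT r s) :
    ColumnLT (BoxBall.rowInsert x r).1 s := by
  induction r generalizing s with
  | nil =>
    cases s with
    | nil => simp
    | cons y s => exact absurd h id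
  | cons a r ih =>
    cases s with
    | nil => simp
    | cons b s =>
      rcases lt_or_ge x a with h1 | h1
      · rw [rowInsert_cons_of_lt h1]
        exact ⟨h1.trans h.1, h.2⟩
      · rw [rowInsert_cons_of_le h1]
        exact ⟨h.1, ih h.2⟩

/-- The entry below the old position of y, if any, exceeds y, so y lands weakly to the left of that
position, where the entries of the new upper row are at most x < y. -/
theorem ColumnLT.rowInsert_rowInsert {x y : α} {r s : List α} (h : ColumnLT r s)
    (hy : (BoxBall.rowInsert x r).2 = some y) :
    ColumnLT (BoxBall.rowInsert x r).1 (BoxBall.rowInsert y s).1 := by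
  induction r generalizing s with
  | nil => simp [BoxBall.rowInsert] at hy
  | cons a r ih =>
    rcases lt_or_ge x a with h1 | h1
    · rw [rowInsert_cons_of_lt h1] at hy ⊢
      simp only [Option.some.injEq] at hy
      subst hy
      cases s with
      | nil => simpa [BoxBall.rowInsert] using h1
      | cons b s =>
        rw [rowInsert_cons_of_lt h.1]
        exact ⟨h1, h.2⟩
    · rw [rowInsert_cons_of_le h1] at hy ⊢
      have hxy := lt_of_rowInsert_eq_some hy
      cases s with
      | nil => simpa [BoxBall.rowInsert] using h1.trans_lt hxy
      | cons b s =>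
        rcases lt_or_ge y b with h2 | h2
        · rw [rowInsert_cons_of_lt h2]
          exact ⟨h1.trans_lt hxy, h.2.rowInsert⟩
        · rw [rowInsert_cons_of_le h2]
          exact ⟨h.1, ih h.2 hy⟩

theorem rowInsert_ne_nil (x : α) (r : List α) : (rowInsert x r).1 ≠ [] :=
  List.ne_nil_of_mem (self_mem_rowInsert x r)

theorem headD_bump (T : Tableau α) (x : α) :
    (bump T x).1.headD [] = (rowInsert x (T.headD [])).1 := by
  cases T with
  | nil => rfl
  | cons r T => rw [bump_cons]; rfl

theorem IsSemistandard.bump {T : Tableau α} (hT : IsSemistandard T) (x : α) :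
    IsSemistandard (BoxBall.bump T x).1 := by
  induction T generalizing x with
  | nil => simp [IsSemistandard, BoxBall.bump]
  | cons r T ih =>
    obtain ⟨_, h1, h2, h3⟩ := hT
    rw [bump_cons]
    refine ⟨rowInsert_ne_nil x r, rowInsert_sorted h1, ?_, ?_⟩
    · rcases h : (rowInsert x r).2 with _ | y
      · exact h2.rowInsert
      · simp only [Option.toList_some, insertWord_cons, insertWord_nil, headD_bump]
        exact h2.rowInsert_rowInsert h
    · cases (rowInsert x r).2 with
      | none => exact h3
      | some y => exact ih h3 y

theorem IsSemistandard.insertWord {T : Tableau α} (hT : IsSemistandard T) (w : List α) :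
    IsSemistandard (BoxBall.insertWord T w) := by
  induction w generalizing T with
  | nil => exact hT
  | cons x w ih => exact ih (hT.bump x)

/-- Each letter of the upper row bumps exactly the entry below it, and the letters with nothing
below them are appended. Thus the upper row takes the place of the lower one, which is pushed down
whole. -/
theorem ColumnLT.rowResult_bumped {r s : List α} (h : ColumnLT r s) (hr : r.Pairwise (· ≤ ·)) :
    rowResult s r = r ∧ bumped s r = s := by
  induction r generalizing s with
  | nil =>
    cases s with
    | nil => exact ⟨rfl, rfl⟩
    | cons y s => exact absurd h id
  | cons x r ih =>
    rw [List.pairwise_cons] at hr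
    cases s with
    | nil =>
      obtain ⟨h1, h2⟩ := ih (columnLT_nil r) hr.2
      rw [rowResult_cons, bumped_cons, BoxBall.rowInsert, rowResult_cons_of_le _ hr.1, bumped,
        rowOut_cons_of_le _ hr.1, h1]
      exact ⟨rfl, h2⟩
    | cons y s =>
      obtain ⟨h1, h2⟩ := ih h.2 hr.2
      rw [rowResult_cons, bumped_cons, rowInsert_cons_of_lt h.1, rowResult_cons_of_le _ hr.1,
        bumped, rowOut_cons_of_le _ hr.1, h1]
      exact ⟨rfl, congrArg (y :: ·) h2⟩

theorem IsSemistandard.insertWord_row {r : List α} {T : Tableau α} (h : IsSemistandard (r :: T)) :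
    BoxBall.insertWord T r = r :: T := by
  induction T generalizing r with
  | nil =>
    obtain ⟨h1, h2⟩ := (columnLT_nil r).rowResult_bumped h.2.1
    rw [insertWord_nil_tableau h.1, insertWord_cons_row, h1, h2, insertWord_nil]
  | cons s T ih =>
    obtain ⟨_, h1, h2, h3⟩ := h
    obtain ⟨h4, h5⟩ := ColumnLT.rowResult_bumped h2 h1
    rw [insertWord_cons_row]
    simp only [List.headD_cons] at h4 h5
    rw [h4, h5, ih h3]

/-- A semistandard tableau is the `P`-symbol of its word. -/
theorem IsSemistandard.insertWord_readingWord {T : Tableau α} (h : IsSemistandard T) :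
    BoxBall.insertWord [] (readingWord T) = T := by
  induction T with
  | nil => rfl
  | cons r T ih => rw [readingWord_cons, insertWord_append, ih h.2.2.2, h.insertWord_row]

end Insertion

/-! ### The carrier algorithm as row insertion -/

section Carrier

variable {α : Type*} [LinearOrder α]

/-- The carrier algorithm `(C, w)` always unloads a number larger than the loaded one. -/
def Loads : List α → List α → Prop
  | _, [] => True
  | C, x :: w => (∃ c ∈ C, x < c) ∧ Loads (reload C x) w

/-- The word produced by the carrier algorithm. -/
abbrev carrierWord (C w : List α) : List α := (carrierAlgorithm C w).2

theorem reload_sorted {C : List α} (hC : C.Pairwise (· ≤ ·)) (x : α) :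
    (reload C x).Pairwise (· ≤ ·) :=
  (hC.sublist List.erase_sublist).orderedInsert _ _

theorem unload_cons_of_lt {x c : α} (h : x < c) (C : List α) : unload (c :: C) x = c := by
  simp [unload, h]

theorem unload_cons_of_le {x c : α} (h : c ≤ x) {C : List α} (hx : ∃ a ∈ C, x < a) :
    unload (c :: C) x = unload C x := by
  have : (C.find? (fun c => decide (x < c))).isSome := by simpa using hx
  obtain ⟨a, ha⟩ := Option.isSome_iff_exists.mp this
  simp [unload, not_lt.mpr h, ha]

theorem unload_spec {C : List α} (hC : C.Pairwise (· ≤ ·)) {x : α} (hx : ∃ c ∈ C, x < c) :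
    unload C x ∈ C ∧ x < unload C x ∧ ∀ c ∈ C, x < c → unload C x ≤ c := by
  induction C with
  | nil => simp at hx
  | cons a C ih =>
    rw [List.pairwise_cons] at hC
    rcases lt_or_ge x a with h | h
    · rw [unload_cons_of_lt h]
      exact ⟨by simp, h, fun c hc _ => (List.mem_cons.mp hc).elim (fun e => e.ge) (hC.1 c)⟩
    · have hx' : ∃ c ∈ C, x < c := by
        obtain ⟨c, hc, hxc⟩ := hx
        rcases List.mem_cons.mp hc with rfl | hc
        · exact absurd hxc (not_lt.mpr h)
        · exact ⟨c, hc, hxc⟩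
      rw [unload_cons_of_le h hx']
      obtain ⟨h1, h2, h3⟩ := ih hC.2 hx'
      refine ⟨List.mem_cons_of_mem _ h1, h2, fun c hc hxc => ?_⟩
      rcases List.mem_cons.mp hc with rfl | hc
      · exact absurd hxc (not_lt.mpr h)
      · exact h3 c hc hxc

/-- The bridge between the two algorithms: in a sorted row the leftmost larger entry is the smallest
larger one. The new rows are sorted and have the same content, hence coincide. -/
theorem rowInsert_eq_reload {C : List α} (hC : C.Pairwise (· ≤ ·)) {x : α}
    (hx : ∃ c ∈ C, x < c) : rowInsert x C = (reload C x, some (unload C x)) := by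
  have h2 : (rowInsert x C).2 = some (unload C x) := by
    obtain ⟨h1, h2, h3⟩ := unload_spec hC hx
    obtain ⟨y, hy, hy'⟩ := exists_rowInsert_eq_some hC h1 h2
    rw [hy', le_antisymm hy (h3 y (mem_of_rowInsert_eq_some hy') (lt_of_rowInsert_eq_some hy'))]
  refine Prod.ext ?_ h2
  refine List.Perm.eq_of_pairwise' (rowInsert_sorted hC) (reload_sorted hC x) ?_
  have hp := rowInsert_perm x C
  rw [h2] at hp
  have h4 : (unload C x :: reload C x).Perm (x :: C) :=
    (((List.perm_orderedInsert _ x _).cons _).trans (List.Perm.swap _ _ _)).trans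
      ((List.perm_cons_erase (unload_spec hC hx).1).symm.cons x)
  exact (hp.trans h4.symm).cons_inv

theorem length_rowInsert (x : α) (r : List α) :
    (rowInsert x r).1.length + (rowInsert x r).2.toList.length = r.length + 1 := by
  have := (rowInsert_perm x r).length_eq
  simp only [List.length_append, List.length_cons] at this
  omega

theorem length_le_length_rowResult (r w : List α) : r.length ≤ (rowResult r w).length := by
  induction w generalizing r with
  | nil => exact le_rfl
  | cons x w ih =>
    rw [rowResult_cons]
    refine le_trans ?_ (ih _)
    have := length_rowInsert x r
    have : (rowInsert x r).2.toList.length ≤ 1 := by cases (rowInsert x r).2 <;> simp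
    omega

theorem Loads.rowResult_bumped {C w : List α} (hC : C.Pairwise (· ≤ ·)) (h : Loads C w) :
    rowResult C w = (carrierAlgorithm C w).1 ∧ bumped C w = carrierWord C w := by
  induction w generalizing C with
  | nil => exact ⟨rfl, rfl⟩
  | cons x w ih =>
    obtain ⟨h1, h2⟩ := ih (reload_sorted hC x) h.2
    rw [rowResult_cons, bumped_cons, rowInsert_eq_reload hC h.1, h1, h2]
    exact ⟨rfl, rfl⟩

theorem length_reload {C : List α} (hC : C.Pairwise (· ≤ ·)) {x : α}
    (hx : ∃ c ∈ C, x < c) : (reload C x).length = C.length := by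
  have := length_rowInsert x C
  rw [rowInsert_eq_reload hC hx] at this
  simpa using this

theorem Loads.length {C w : List α} (hC : C.Pairwise (· ≤ ·)) (h : Loads C w) :
    (carrierAlgorithm C w).1.length = C.length := by
  induction w generalizing C with
  | nil => rfl
  | cons x w ih => exact (ih (reload_sorted hC x) h.2).trans (length_reload hC h.1)

/-- A letter with nothing larger in the row would lengthen it, and a row never gets shorter. The
criterion sees only the final row, so it passes from a word to any plactic equivalent one. -/
theorem loads_of_length_rowResult {C w : List α} (hC : C.Pairwise (· ≤ ·))
    (h : (rowResult C w).length = C.length) : Loads C w := by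
  induction w generalizing C with
  | nil => trivial
  | cons x w ih =>
    have hx : ∃ c ∈ C, x < c := by
      by_contra! hx
      have h1 := length_le_length_rowResult (rowInsert x C).1 w
      rw [rowResult_cons] at h
      rw [h, rowInsert_eq_of_forall_le hx] at h1
      simp at h1
    refine ⟨hx, ih (reload_sorted hC x) ?_⟩
    rw [rowResult_cons, rowInsert_eq_reload hC hx] at h
    rw [h, length_reload hC hx]

theorem carrierAlgorithm_append (C u v : List α) :
    carrierAlgorithm C (u ++ v) = ((carrierAlgorithm (carrierAlgorithm C u).1 v).1,
      carrierWord C u ++ carrierWord (carrierAlgorithm C u).1 v) := by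
  induction u generalizing C with
  | nil => rfl
  | cons x u ih => simp [carrierAlgorithm, carrierWord, ih]

theorem length_carrierWord (C w : List α) : (carrierWord C w).length = w.length := by
  induction w generalizing C with
  | nil => rfl
  | cons x w ih => simpa [carrierAlgorithm, carrierWord] using ih (reload C x)

theorem carrierAlgorithm_sorted {C : List α} (hC : C.Pairwise (· ≤ ·)) (w : List α) :
    (carrierAlgorithm C w).1.Pairwise (· ≤ ·) := by
  induction w generalizing C with
  | nil => exact hC
  | cons x w ih => exact ih (reload_sorted hC x)

theorem loads_append {C u v : List α} :
    Loads C (u ++ v) ↔ Loads C u ∧ Loads (carrierAlgorithm C u).1 v := by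
  induction u generalizing C with
  | nil => simp [Loads, carrierAlgorithm]
  | cons x u ih => simp [Loads, carrierAlgorithm, ih, and_assoc]

theorem bumped_eq_nil_of_none {y : α} {r w : List α} (hw : (y :: w).Pairwise (· ≤ ·))
    (hy : (rowInsert y r).2 = none) : bumped (rowInsert y r).1 w = [] := by
  induction w generalizing y r with
  | nil => rfl
  | cons z w ih =>
    rw [List.pairwise_cons] at hw
    have hz := rowInsert_none_of_none (hw.1 z (by simp)) hy
    rw [bumped_cons, hz, ih hw.2 hz]
    rfl

/-- The numbers bumped out by a weakly increasing word are weakly increasing. -/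
theorem bumped_sorted {r w : List α} (hr : r.Pairwise (· ≤ ·)) (hw : w.Pairwise (· ≤ ·)) :
    (bumped r w).Pairwise (· ≤ ·) := by
  rw [← List.isChain_iff_pairwise]
  induction w generalizing r with
  | nil => simp
  | cons y w ih =>
    rcases hy : (rowInsert y r).2 with _ | a
    · rw [bumped_cons, bumped_eq_nil_of_none hw hy, hy]
      simp
    · rw [List.pairwise_cons] at hw
      have ih' := ih (rowInsert_sorted (x := y) hr) hw.2
      rw [bumped_cons, hy]
      cases w with
      | nil => simp
      | cons z w =>
        rcases hz : (rowInsert z (rowInsert y r).1).2 with _ | b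
        · rw [bumped_cons, bumped_eq_nil_of_none hw.2 hz, hz]
          simp
        · rw [bumped_cons, hz] at ih' ⊢
          exact List.isChain_cons_cons.mpr ⟨bumped_le hr (hw.1 z (by simp)) hy hz, ih'⟩

theorem carrierWord_sorted {C w : List α} (hC : C.Pairwise (· ≤ ·)) (hw : w.Pairwise (· ≤ ·))
    (h : Loads C w) : (carrierWord C w).Pairwise (· ≤ ·) := by
  rw [← (h.rowResult_bumped hC).2]
  exact bumped_sorted hC hw

@[simp] theorem carrierWord_nil (C : List α) : carrierWord C [] = [] := rfl

theorem carrierWord_cons (C w : List α) (x : α) :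
    carrierWord C (x :: w) = unload C x :: carrierWord (reload C x) w := rfl

theorem carrierAlgorithm_cons_fst (C w : List α) (x : α) :
    (carrierAlgorithm C (x :: w)).1 = (carrierAlgorithm (reload C x) w).1 := rfl

theorem reload_cons_of_lt {h x : α} {C : List α} (hC : (h :: C).Pairwise (· ≤ ·)) (hx : x < h) :
    reload (h :: C) x = x :: C := by
  have := rowInsert_eq_reload hC ⟨h, by simp, hx⟩
  rw [rowInsert_cons_of_lt hx] at this
  exact (congrArg Prod.fst this).symm

theorem exists_of_exists_cons {h x : α} {C : List α} (hx : ∃ c ∈ h :: C, x < c) (hh : h ≤ x) :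
    ∃ c ∈ C, x < c := by
  obtain ⟨c, hc, hxc⟩ := hx
  rcases List.mem_cons.mp hc with rfl | hc
  · exact absurd hxc (not_lt.mpr hh)
  · exact ⟨c, hc, hxc⟩

theorem reload_cons_of_le {h x : α} {C : List α} (hC : (h :: C).Pairwise (· ≤ ·)) (hh : h ≤ x)
    (hx : ∃ c ∈ C, x < c) : reload (h :: C) x = h :: reload C x := by
  have h1 := rowInsert_eq_reload hC (hx.imp fun c hc => ⟨List.mem_cons_of_mem _ hc.1, hc.2⟩)
  rw [rowInsert_cons_of_le hh, rowInsert_eq_reload (List.pairwise_cons.mp hC).2 hx] at h1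
  exact (congrArg Prod.fst h1).symm

/-- A carrier number not larger than any of the letters can be removed. -/
theorem Loads.of_cons {h : α} {C w : List α} (hC : (h :: C).Pairwise (· ≤ ·))
    (hw : ∀ x ∈ w, h ≤ x) (hl : Loads (h :: C) w) :
    Loads C w ∧ carrierWord (h :: C) w = carrierWord C w ∧
      (carrierAlgorithm (h :: C) w).1 = h :: (carrierAlgorithm C w).1 := by
  induction w generalizing C with
  | nil => exact ⟨trivial, rfl, rfl⟩
  | cons x w ih =>
    have hx := exists_of_exists_cons hl.1 (hw x (by simp))
    have e := reload_cons_of_le hC (hw x (by simp)) hx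
    have hl2 := hl.2
    rw [e] at hl2
    obtain ⟨h1, h2, h3⟩ := ih (e ▸ reload_sorted hC x) (fun a ha => hw a (by simp [ha])) hl2
    rw [carrierWord_cons, carrierAlgorithm_cons_fst, e, h2, h3,
      unload_cons_of_le (hw x (by simp)) hx]
    exact ⟨⟨hx, h1⟩, rfl, rfl⟩

/-! ### The carrier algorithm preserves semistandardness. -/

theorem columnLT_cons_left {a : α} {s l : List α} :
    ColumnLT (a :: s) l ↔ (∀ g ∈ l.head?, a < g) ∧ ColumnLT s l.tail := by
  cases l <;> simp

theorem lt_of_mem_carrierWord {C w : List α} (hC : C.Pairwise (· ≤ ·)) (hl : Loads C w) {y a : α}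
    (hw : ∀ x ∈ w, y ≤ x) (ha : a ∈ carrierWord C w) : y < a := by
  induction w generalizing C with
  | nil => simp at ha
  | cons x w ih =>
    rw [carrierWord_cons, List.mem_cons] at ha
    rcases ha with rfl | ha
    · exact (hw x (by simp)).trans_lt (unload_spec hC hl.1).2.1
    · exact ih (reload_sorted hC x) hl.2 (fun b hb => hw b (by simp [hb])) ha

/-- Here s is the upper row and r the lower one, which is loaded first. The induction removes the
head of the carrier, which can be replaced at most once by r and then at most once by s. If only one
of the two rows uses it, the alignment of the rows shifts by one; the offset k, which is 0 in the
application, absorbs these shifts. -/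
theorem columnLT_carrierWord_drop {C r s : List α} {k : ℕ} (hC : C.Pairwise (· ≤ ·))
    (hr : r.Pairwise (· ≤ ·)) (hs : s.Pairwise (· ≤ ·)) (hlr : Loads C r)
    (hls : Loads (carrierAlgorithm C r).1 s) (h : ColumnLT s (r.drop k)) :
    ColumnLT (carrierWord (carrierAlgorithm C r).1 s) ((carrierWord C r).drop k) := by
  induction C generalizing r s k with
  | nil =>
    cases r with
    | nil => simp
    | cons x r => simp [Loads] at hlr
  | cons c C ih =>
    have hC' := (List.pairwise_cons.mp hC).2
    cases s with
    | nil =>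
      have h1 : r.drop k = [] := by
        cases e : r.drop k with
        | nil => rfl
        | cons y l => rw [e] at h; exact False.elim h
      rw [List.drop_eq_nil_iff] at h1
      rw [List.drop_eq_nil_of_le (by rwa [length_carrierWord])]
      simp
    | cons s₁ s =>
    cases r with
    | nil => simp
    | cons r₁ r =>
    have hs' := List.pairwise_cons.mp hs
    have hr' := List.pairwise_cons.mp hr
    rcases lt_or_ge r₁ c with h1 | h1
    · have e := reload_cons_of_lt hC h1
      have hC1 : (r₁ :: C).Pairwise (· ≤ ·) := e ▸ reload_sorted hC r₁
      have hlr2 := hlr.2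
      rw [e] at hlr2
      obtain ⟨l1, l2, l3⟩ := hlr2.of_cons hC1 hr'.1
      rw [carrierAlgorithm_cons_fst, e, l3] at hls ⊢
      rw [carrierWord_cons (c :: C), e, unload_cons_of_lt h1, l2]
      have hD : (r₁ :: (carrierAlgorithm C r).1).Pairwise (· ≤ ·) :=
        l3 ▸ carrierAlgorithm_sorted hC1 r
      rcases lt_or_ge s₁ r₁ with h2 | h2
      · have e' := reload_cons_of_lt hD h2
        have hD1 : (s₁ :: (carrierAlgorithm C r).1).Pairwise (· ≤ ·) := e' ▸ reload_sorted hD s₁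
        have hls2 := hls.2
        rw [e'] at hls2
        obtain ⟨m1, m2, m3⟩ := hls2.of_cons hD1 hs'.1
        rw [carrierWord_cons, e', unload_cons_of_lt h2, m2]
        cases k with
        -- Both rows use the head of the carrier: r unloads c and leaves r₁ there, which s then
        -- unloads, and r₁ < c.
        | zero => exact ⟨h1, ih hC' hr'.2 hs'.2 l1 m1 (k := 0) h.2⟩
        | succ k =>
          rw [List.drop_succ_cons] at h ⊢
          rw [columnLT_cons_left, List.tail_drop] at h ⊢
          refine ⟨fun g hg => ?_, ih hC' hr'.2 hs'.2 l1 m1 h.2⟩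
          exact lt_of_mem_carrierWord hC' l1 hr'.1
            (List.mem_of_mem_drop (List.mem_of_mem_head? hg))
      · have hle : ∀ a ∈ s₁ :: s, r₁ ≤ a := by
          simpa [h2] using fun a ha => h2.trans (hs'.1 a ha)
        obtain ⟨m1, m2, m3⟩ := hls.of_cons hD hle
        rw [m2]
        -- Only r has used the head, so r loses its first letter while s stays whole, and the offset
        -- drops by one. Offset 0 would force s₁ < r₁.
        cases k with
        | zero => exact absurd h.1 (not_lt.mpr h2)
        | succ k => exact ih hC' hr'.2 hs l1 m1 h
    · have hle : ∀ a ∈ r₁ :: r, c ≤ a := by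
        simpa [h1] using fun a ha => h1.trans (hr'.1 a ha)
      obtain ⟨l1, l2, l3⟩ := hlr.of_cons hC hle
      rw [l3] at hls ⊢
      rw [l2]
      have hD : (c :: (carrierAlgorithm C (r₁ :: r)).1).Pairwise (· ≤ ·) :=
        l3 ▸ carrierAlgorithm_sorted hC _
      rcases lt_or_ge s₁ c with h2 | h2
      · have e' := reload_cons_of_lt hD h2
        have hD1 := e' ▸ reload_sorted hD s₁
        have hls2 := hls.2
        rw [e'] at hls2
        obtain ⟨m1, m2, m3⟩ := hls2.of_cons hD1 hs'.1
        rw [carrierWord_cons, e', unload_cons_of_lt h2, m2]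
        -- Only s has used the head c, so the offset rises by one. All letters of r are at least c,
        -- hence every number that r unloads exceeds c.
        rw [columnLT_cons_left, List.tail_drop] at h ⊢
        refine ⟨fun g hg => ?_, ih hC' hr hs'.2 l1 m1 h.2⟩
        exact lt_of_mem_carrierWord hC' l1 hle
          (List.mem_of_mem_drop (List.mem_of_mem_head? hg))
      · have hle' : ∀ a ∈ s₁ :: s, c ≤ a := by
          simpa [h2] using fun a ha => h2.trans (hs'.1 a ha)
        obtain ⟨m1, m2, m3⟩ := hls.of_cons hD hle'
        rw [m2]
        exact ih hC' hr hs l1 m1 h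

/-- The carrier algorithm turns the word of a semistandard tableau into the word of a
semistandard tableau of the same shape. -/
theorem IsSemistandard.exists_carrierWord {T : Tableau α} (hT : IsSemistandard T) {C : List α}
    (hC : C.Pairwise (· ≤ ·)) (hl : Loads C (readingWord T)) :
    ∃ T' : Tableau α, IsSemistandard T' ∧ shape T' = shape T ∧
      readingWord T' = carrierWord C (readingWord T) := by
  induction T with
  | nil => exact ⟨[], trivial, rfl, rfl⟩
  | cons r T ih =>
    obtain ⟨h0, h1, h2, h3⟩ := hT
    rw [readingWord_cons, loads_append] at hl
    obtain ⟨T', hT', hsh, hw⟩ := ih h3 hl.1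
    set D := (carrierAlgorithm C (readingWord T)).1 with hD
    have hDs : D.Pairwise (· ≤ ·) := carrierAlgorithm_sorted hC _
    refine ⟨carrierWord D r :: T', ⟨?_, carrierWord_sorted hDs h1 hl.2, ?_, hT'⟩, ?_, ?_⟩
    · rw [← List.length_pos_iff, length_carrierWord]
      exact List.length_pos_iff.mpr h0
    · cases T with
      | nil =>
        have : T' = [] := by simpa [shape] using hsh
        simp [this]
      | cons s T =>
        obtain ⟨s', T', rfl⟩ : ∃ s' T'', T' = s' :: T'' := by
          cases T' with
          | nil => simp [shape] at hsh
          | cons s' T'' => exact ⟨s', T'', rfl⟩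
        simp only [shape, List.map_cons, List.cons.injEq] at hsh
        rw [readingWord_cons, readingWord_cons, carrierWord, carrierAlgorithm_append] at hw
        -- Equal lengths allow the word to be cut, which identifies the first row of T' with the
        -- carrier output of the row s.
        have hs' := (List.append_inj' hw (by rw [length_carrierWord]; exact hsh.1)).2
        rw [readingWord_cons, loads_append] at hl
        rw [readingWord_cons, carrierAlgorithm_append] at hD
        have := columnLT_carrierWord_drop (k := 0) (carrierAlgorithm_sorted hC (readingWord T))
          h3.2.1 h1 hl.1.2 (by simpa [hD] using hl.2) (by simpa using h2)
        rw [hD, List.headD_cons, hs']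
        simpa using this
    · simpa [shape, length_carrierWord] using hsh
    · rw [readingWord_cons, readingWord_cons, hw]
      simp only [carrierWord, carrierAlgorithm_append, hD]

/-- The carrier algorithm acts on the `P`-symbol of a word through its word. -/
theorem insertWord_carrierWord {C w : List α} (hC : C.Pairwise (· ≤ ·)) (hl : Loads C w) :
    shape (insertWord [] (carrierWord C w)) = shape (insertWord [] w) ∧
      readingWord (insertWord [] (carrierWord C w)) =
        carrierWord C (readingWord (insertWord [] w)) := by
  have hss : IsSemistandard (insertWord [] w) := IsSemistandard.insertWord (T := []) trivial w
  -- Plactic equivalence is tested on the tableau whose only row is the carrier: first rows give the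
  -- final carriers, the rest gives the insertion tableaux of the outputs.
  have hT := placticEq_readingWord_insertWord w [C] (by simpa [RowsSorted] using hC)
  rw [insertWord_cons_row, insertWord_cons_row, List.cons.injEq] at hT
  have hl' : Loads C (readingWord (insertWord [] w)) := by
    apply loads_of_length_rowResult hC
    rw [← hT.1, (hl.rowResult_bumped hC).1, hl.length hC]
  obtain ⟨T', h1, h2, h3⟩ := hss.exists_carrierWord hC hl'
  rw [(hl.rowResult_bumped hC).2, (hl'.rowResult_bumped hC).2, ← h3,
    h1.insertWord_readingWord] at hT
  rw [hT.2]
  exact ⟨h2, h3⟩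

/-! ### Recording tableaux -/

/-- The shape of `bump T x` determines the row of the new box. -/
theorem bump_snd_congr {β : Type*} [LinearOrder β] {T : Tableau α} {U : Tableau β} {x : α} {y : β}
    (h : shape T = shape U) (h' : shape (bump T x).1 = shape (bump U y).1) :
    (bump T x).2 = (bump U y).2 := by
  induction T generalizing U x y with
  | nil =>
    cases U with
    | nil => rfl
    | cons s U => simp [shape] at h
  | cons r T ih =>
    cases U with
    | nil => simp [shape] at h
    | cons s U =>
      have l1 := length_rowInsert x r
      have l2 := length_rowInsert y s
      simp only [shape, List.map_cons, List.cons.injEq] at h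
      rcases e1 : rowInsert x r with ⟨r', _ | a⟩ <;> rcases e2 : rowInsert y s with ⟨s', _ | b⟩ <;>
        simp only [bump, e1, e2, shape, List.map_cons, List.cons.injEq] at h' l1 l2 ⊢ <;>
        simp only [Option.toList_none, Option.toList_some, List.length_nil,
          List.length_cons] at l1 l2
      · omega
      · omega
      · rw [ih h.2 h'.2]

theorem rsk_append {β : Type*} (w : List (β × α)) (c : β × α) :
    rsk (w ++ [c]) = ((bump (rsk w).1 c.2).1, addBox c.1 (bump (rsk w).1 c.2).2 (rsk w).2) := by
  simp [rsk]

theorem rsk_fst {β : Type*} (w : List (β × α)) :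
    (rsk w).1 = insertWord [] (w.map Prod.snd) := by
  induction w using List.reverseRecOn with
  | nil => rfl
  | append_singleton w c ih => simp [rsk_append, ih, insertWord_append]

/-- The `Q`-symbol depends only on the top row and on the shapes of the `P`-symbols. -/
theorem rsk_snd_congr {β : Type*} {c : List β} {u v : List α}
    (hu : u.length = c.length) (hv : v.length = c.length)
    (h : ∀ k, shape (insertWord [] (u.take k)) = shape (insertWord [] (v.take k))) :
    (rsk (c.zip u)).2 = (rsk (c.zip v)).2 := by
  induction c using List.reverseRecOn generalizing u v with
  | nil => rfl
  | append_singleton c i ih =>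
    rcases List.eq_nil_or_concat' u with rfl | ⟨u, x, rfl⟩
    · simp at hu
    rcases List.eq_nil_or_concat' v with rfl | ⟨v, y, rfl⟩
    · simp at hv
    simp only [List.length_append, List.length_singleton, Nat.add_right_cancel_iff] at hu hv
    rw [List.zip_append hu.symm, List.zip_append hv.symm]
    have h1 : ∀ k ≤ c.length, shape (insertWord [] (u.take k)) =
        shape (insertWord [] (v.take k)) := by
      intro k hk
      have := h k
      rwa [List.take_append_of_le_length (hu ▸ hk), List.take_append_of_le_length (hv ▸ hk)] at this
    have h2 : ∀ k, shape (insertWord [] (u.take k)) = shape (insertWord [] (v.take k)) := by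
      intro k
      rcases le_total k c.length with hk | hk
      · exact h1 k hk
      · have := h1 c.length le_rfl
        rw [List.take_of_length_le (hu ▸ le_rfl), List.take_of_length_le (hv ▸ le_rfl)] at this
        rwa [List.take_of_length_le (hu ▸ hk), List.take_of_length_le (hv ▸ hk)]
    have h3 := h (c.length + 1)
    rw [List.take_of_length_le (by simp [hu]), List.take_of_length_le (by simp [hv]),
      insertWord_append, insertWord_append] at h3
    have h4 := h1 c.length le_rfl
    rw [List.take_of_length_le (hu ▸ le_rfl), List.take_of_length_le (hv ▸ le_rfl)] at h4
    simp only [List.zip_cons_cons, List.zip_nil_left, rsk_append, ih hu hv h2, rsk_fst,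
      List.map_snd_zip hu.le, List.map_snd_zip hv.le, bump_snd_congr h4 h3]

theorem readingWord_bump_perm (T : Tableau α) (x : α) :
    (readingWord (bump T x).1).Perm (x :: readingWord T) := by
  induction T generalizing x with
  | nil => simp [bump, readingWord]
  | cons r T ih =>
    rw [bump_cons, readingWord_cons, readingWord_cons]
    have h := rowInsert_perm x r
    cases e : (rowInsert x r).2 with
    | none =>
      rw [e] at h
      exact (h.append_left _).trans List.perm_middle
    | some y =>
      rw [e] at h
      refine ((ih y).append_right _).trans ?_
      refine (List.perm_middle.symm.trans (h.append_left _)).trans List.perm_middle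

theorem readingWord_insertWord_perm (w : List α) : (readingWord (insertWord [] w)).Perm w := by
  induction w using List.reverseRecOn with
  | nil => exact List.Perm.nil
  | append_singleton w x ih =>
    rw [insertWord_append]
    exact (readingWord_bump_perm _ x).trans ((ih.cons x).trans
      (List.perm_append_singleton x w).symm)

end Carrier

/-! ### The symmetry of the RSK correspondence -/

section Symmetry

variable {α β : Type*} [LinearOrder α]

/-- The columns whose bottom entries are bumped out of a row. -/
def residual : List α → List (β × α) → List (β × α)
  | _, [] => []
  | r, c :: w => (rowInsert c.2 r).2.toList.map (c.1, ·) ++ residual (rowInsert c.2 r).1 w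

/-- The top entries of the columns whose insertion makes a row longer. -/
def newLabels : List α → List (β × α) → List β
  | _, [] => []
  | r, c :: w => (if (rowInsert c.2 r).2 = none then [c.1] else []) ++
      newLabels (rowInsert c.2 r).1 w

/-- One step of the RSK correspondence. -/
def rskStep (PQ : Tableau α × Tableau β) (c : β × α) : Tableau α × Tableau β :=
  ((bump PQ.1 c.2).1, addBox c.1 (bump PQ.1 c.2).2 PQ.2)

theorem rsk_eq_foldl (w : List (β × α)) : rsk w = w.foldl rskStep ([], []) := rfl

/-- The first rows of both symbols split off together, and the lower rows form the correspondence
for the residual bi-word. This is the recursion behind the symmetry. -/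
theorem foldl_rskStep_cons (r : List α) (T : Tableau α) (q : List β) (U : Tableau β)
    (w : List (β × α)) :
    w.foldl rskStep (r :: T, q :: U) =
      (rowResult r (w.map Prod.snd) :: ((residual r w).foldl rskStep (T, U)).1,
        (q ++ newLabels r w) :: ((residual r w).foldl rskStep (T, U)).2) := by
  induction w generalizing r T q U with
  | nil => simp [residual, newLabels]
  | cons c w ih =>
    rcases e : rowInsert c.2 r with ⟨r', _ | y⟩ <;>
      simp [rskStep, bump, e, addBox, ih, residual, newLabels]

theorem rsk_eq_cons {w : List (β × α)} (hw : w ≠ []) :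
    rsk w = (rowResult [] (w.map Prod.snd) :: (rsk (residual [] w)).1,
      newLabels [] w :: (rsk (residual [] w)).2) := by
  have h : rsk w = w.foldl rskStep ([[]], [[]]) := by
    cases w with
    | nil => exact absurd rfl hw
    | cons c w => simp [rsk_eq_foldl, rskStep, bump, addBox, rowInsert]
  rw [h, foldl_rskStep_cons]
  rfl

theorem residual_append (r : List α) (u v : List (β × α)) :
    residual r (u ++ v) = residual r u ++ residual (rowResult r (u.map Prod.snd)) v := by
  induction u generalizing r with
  | nil => rfl
  | cons c u ih => simp [residual, ih]

theorem newLabels_append (r : List α) (u v : List (β × α)) :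
    newLabels r (u ++ v) = newLabels r u ++ newLabels (rowResult r (u.map Prod.snd)) v := by
  induction u generalizing r with
  | nil => rfl
  | cons c u ih => simp [newLabels, ih]

theorem residual_map_mk (r u : List α) (i : β) :
    residual r (u.map (i, ·)) = (bumped r u).map (i, ·) := by
  induction u generalizing r with
  | nil => rfl
  | cons x u ih => simp [residual, ih, bumped_cons]

theorem newLabels_map_mk (r u : List α) (i : β) :
    newLabels r (u.map (i, ·)) = List.replicate ((rowOut r u).count none) i := by
  induction u generalizing r with
  | nil => rfl
  | cons x u ih =>
    rcases h : (rowInsert x r).2 with _ | y <;>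
      simp [newLabels, ih, h, List.replicate_succ]

theorem length_residual_le (r : List α) (w : List (β × α)) :
    (residual r w).length ≤ w.length := by
  induction w generalizing r with
  | nil => exact le_rfl
  | cons c w ih =>
    have := ih (rowInsert c.2 r).1
    cases h : (rowInsert c.2 r).2 <;> simp [residual, h] <;> omega

/-- The first letter enters an empty row and bumps nothing; this makes the recursion on residual
bi-words terminate. -/
theorem length_residual_lt {w : List (β × α)} (hw : w ≠ []) :
    (residual [] w).length < w.length := by
  cases w with
  | nil => exact absurd rfl hw
  | cons c w =>
    have := length_residual_le [c.2] w
    simp [residual, rowInsert]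
    omega

/-- The weakly increasing word containing `m j` times each letter `j < b`. -/
def rowWord (b : ℕ) (m : ℕ → ℕ) : List ℕ := (List.range b).flatMap fun j => List.replicate (m j) j

theorem rowWord_succ (b : ℕ) (m : ℕ → ℕ) :
    rowWord (b + 1) m = rowWord b m ++ List.replicate (m b) b := by
  simp [rowWord, List.range_succ]

theorem mem_rowWord {b : ℕ} {m : ℕ → ℕ} {j : ℕ} : j ∈ rowWord b m ↔ j < b ∧ m j ≠ 0 := by
  simp only [rowWord, List.mem_flatMap, List.mem_range, List.mem_replicate]
  constructor
  · rintro ⟨k, hk, hm, rfl⟩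
    exact ⟨hk, hm⟩
  · rintro ⟨h1, h2⟩
    exact ⟨j, h1, h2, rfl⟩

/-- When the word with multiplicities `m` is inserted into the row with multiplicities `x`, the
number of letters smaller than `j` that bump no number smaller than `j`. -/
def pending (x m : ℕ → ℕ) : ℕ → ℕ
  | 0 => 0
  | j + 1 => pending x m j - min (x j) (pending x m j) + m j

/-- Letters that bump something in r do so as before. The y letters that would have been appended to
r now bump copies of b as long as there are any. -/
theorem rowResult_append_replicate {r u : List α} {b : α} (hr : ∀ a ∈ r, a < b)
    (hu : ∀ a ∈ u, a < b) {B : List α} {x y : ℕ}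
    (h : rowOut r u = B.map some ++ List.replicate y none) :
    rowResult (r ++ List.replicate x b) u = rowResult r u ++ List.replicate (x - y) b ∧
      rowOut (r ++ List.replicate x b) u =
        B.map some ++ (List.replicate (min x y) (some b) ++ List.replicate (y - x) none) := by
  induction u generalizing r B x y with
  | nil =>
    have h0 := congrArg List.length h
    simp only [rowOut_nil, List.length_nil, List.length_append, List.length_map,
      List.length_replicate] at h0
    obtain rfl : y = 0 := by omega
    obtain rfl : B = [] := List.length_eq_zero_iff.mp (by omega)
    simp
  | cons a u ih =>
    have ha := hu a (by simp)
    have hu' : ∀ c ∈ u, c < b := fun c hc => hu c (by simp [hc])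
    have hr' : ∀ c ∈ (rowInsert a r).1, c < b := fun c hc =>
      (mem_rowInsert hc).elim (fun e => e ▸ ha) (hr c)
    have hsome : ∀ (s : List α) (t : List α) c, (rowInsert a s).2 = some c →
        rowInsert a (s ++ t) = ((rowInsert a s).1 ++ t, some c) := by
      intro s t c hc
      induction s with
      | nil => simp [rowInsert] at hc
      | cons d s ihs =>
        rcases lt_or_ge a d with h1 | h1
        · rw [rowInsert_cons_of_lt h1] at hc ⊢
          rw [List.cons_append, rowInsert_cons_of_lt h1]
          simpa using hc
        · rw [rowInsert_cons_of_le h1] at hc ⊢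
          rw [List.cons_append, rowInsert_cons_of_le h1, ihs hc]
          rfl
    have hnone : ∀ (s : List α) (t : List α), (∀ d ∈ s, d ≤ a) →
        rowInsert a (s ++ t) = (s ++ (rowInsert a t).1, (rowInsert a t).2) := by
      intro s t hs
      induction s with
      | nil => rfl
      | cons d s ihs =>
        rw [List.cons_append, rowInsert_cons_of_le (hs d (by simp)),
          ihs fun c hc => hs c (by simp [hc])]
        rfl
    rw [rowOut_cons] at h
    rcases hx : (rowInsert a r).2 with _ | c
    · cases B with
      | cons d B => simp [hx] at h
      | nil =>
        cases y with
        | zero => simp at h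
        | succ y =>
          have h' := (List.cons.inj h).2
          have hle := forall_le_of_rowInsert_eq_none hx
          cases x with
          | zero =>
            simp [hx, h', List.replicate_succ]
          | succ x =>
            obtain ⟨h1, h2⟩ := ih hr' hu' (B := []) (x := x) h'
            have e : rowInsert a (r ++ List.replicate (x + 1) b) =
                ((rowInsert a r).1 ++ List.replicate x b, some b) := by
              rw [hnone r _ hle, List.replicate_succ, rowInsert_cons_of_lt ha,
                rowInsert_eq_of_forall_le hle]
              simp
            rw [rowResult_cons, rowOut_cons, e, h1, h2]
            simp [List.replicate_succ]
    · cases B with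
      | nil =>
        cases y with
        | zero => simp at h
        | succ y => simp [hx, List.replicate_succ] at h
      | cons d B =>
        have h' := List.cons.inj h
        obtain ⟨h1, h2⟩ := ih hr' hu' (x := x) h'.2
        rw [rowResult_cons, rowOut_cons, hsome r _ c hx, h1, h2]
        simp [← h'.1, hx]

theorem rowResult_replicate {r : List α} {b : α} (hr : ∀ a ∈ r, a ≤ b) (m : ℕ) :
    rowResult r (List.replicate m b) = r ++ List.replicate m b ∧
      rowOut r (List.replicate m b) = List.replicate m none := by
  induction m generalizing r with
  | zero => simp
  | succ m ih =>
    obtain ⟨h1, h2⟩ := ih (r := r ++ [b]) (by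
      intro a ha
      rcases List.mem_append.mp ha with ha | ha
      · exact hr a ha
      · exact (List.mem_singleton.mp ha).le)
    rw [List.replicate_succ, rowResult_cons, rowOut_cons, rowInsert_eq_of_forall_le hr, h1, h2]
    simp [List.replicate_succ]

/-- The alphabet grows by one letter b at a time: the pending letters first consume the copies of b
in the row, then the copies of b in the word are appended and join the pending ones. -/
theorem rowResult_rowWord (b : ℕ) (x m : ℕ → ℕ) :
    rowResult (rowWord b x) (rowWord b m) =
        rowWord b (fun j => x j - min (x j) (pending x m j) + m j) ∧
      rowOut (rowWord b x) (rowWord b m) =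
        (rowWord b fun j => min (x j) (pending x m j)).map some ++
          List.replicate (pending x m b) none := by
  induction b with
  | zero => simp [rowWord, pending]
  | succ b ih =>
    have hlt : ∀ n : ℕ → ℕ, ∀ a ∈ rowWord b n, a < b := fun n a ha => (mem_rowWord.mp ha).1
    obtain ⟨h1, h2⟩ := rowResult_append_replicate (x := x b) (hlt x) (hlt m) ih.2
    have hle : ∀ a ∈ rowWord b (fun j => x j - min (x j) (pending x m j) + m j) ++
        List.replicate (x b - pending x m b) b, a ≤ b := by
      intro a ha
      rcases List.mem_append.mp ha with ha | ha
      · exact (hlt _ a ha).le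
      · exact (List.eq_of_mem_replicate ha).le
    rw [ih.1] at h1
    obtain ⟨h3, h4⟩ := rowResult_replicate hle (m b)
    rw [rowWord_succ b m, rowWord_succ b x, rowResult_append, rowOut_append, h1, h2, h3, h4,
      rowWord_succ, rowWord_succ]
    have e1 : x b - min (x b) (pending x m b) = x b - pending x m b := by omega
    have e2 : pending x m b - min (x b) (pending x m b) = pending x m b - x b := by omega
    simp only [pending, e1, e2, List.replicate_add, List.map_append, List.map_replicate,
      List.append_assoc, and_self]

/-- The bi-word of a matrix of multiplicities. -/
def matrixWord (a b : ℕ) (M : ℕ → ℕ → ℕ) : List (ℕ × ℕ) :=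
  (List.range a).flatMap fun i => (rowWord b (M i)).map (i, ·)

theorem matrixWord_succ (a b : ℕ) (M : ℕ → ℕ → ℕ) :
    matrixWord (a + 1) b M = matrixWord a b M ++ (rowWord b (M a)).map (a, ·) := by
  simp [matrixWord, List.range_succ]

/-- The multiplicities in the first row of the `P`-symbol after the insertion of the first `i`
rows of the matrix `M`. -/
def rowMult (M : ℕ → ℕ → ℕ) : ℕ → ℕ → ℕ
  | 0, _ => 0
  | i + 1, j => rowMult M i j - min (rowMult M i j) (pending (rowMult M i) (M i) j) + M i j

/-- The number of letters `j' < j` among the `i`-th row of the matrix that bump no number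
smaller than `j`. -/
def pendingMult (M : ℕ → ℕ → ℕ) (i j : ℕ) : ℕ := pending (rowMult M i) (M i) j

theorem pendingMult_zero_right (M : ℕ → ℕ → ℕ) (i : ℕ) : pendingMult M i 0 = 0 := rfl

theorem pendingMult_succ (M : ℕ → ℕ → ℕ) (i j : ℕ) : pendingMult M i (j + 1) =
    pendingMult M i j - min (rowMult M i j) (pendingMult M i j) + M i j := rfl

theorem rowMult_succ (M : ℕ → ℕ → ℕ) (i j : ℕ) : rowMult M (i + 1) j =
    rowMult M i j - min (rowMult M i j) (pendingMult M i j) + M i j := rfl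

/-- The heart of the symmetry. With x = `rowMult` and y = `pendingMult` at (i, j), the local rule
sends x and y to x - min x y + M i j and y - min x y + M i j, at (i + 1, j) and (i, j + 1)
respectively. It is invariant under exchanging x with y and i with j, and so are the zero boundary
values. -/
theorem rowMult_swap (M : ℕ → ℕ → ℕ) (i j : ℕ) :
    rowMult (fun i j => M j i) j i = pendingMult M i j ∧
      pendingMult (fun i j => M j i) j i = rowMult M i j := by
  induction i generalizing j with
  | zero =>
    refine ⟨?_, rfl⟩
    induction j with
    | zero => rfl
    | succ j ih =>
      rw [rowMult_succ, pendingMult_succ, ih, pendingMult_zero_right]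
      simp [rowMult]
  | succ i ih =>
    have key : ∀ j, pendingMult (fun i j => M j i) j (i + 1) = rowMult M (i + 1) j := by
      intro j
      rw [pendingMult_succ, rowMult_succ, (ih j).1, (ih j).2, min_comm]
    have key' : rowMult (fun i j => M j i) j (i + 1) = pendingMult M (i + 1) j := by
      induction j with
      | zero => rfl
      | succ j ihj =>
        rw [rowMult_succ, ihj, key j, min_comm]
        rfl
    exact ⟨key', key j⟩

theorem rowResult_matrixWord (a b : ℕ) (M : ℕ → ℕ → ℕ) :
    rowResult [] ((matrixWord a b M).map Prod.snd) = rowWord b (rowMult M a) ∧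
      residual [] (matrixWord a b M) =
        matrixWord a b (fun i j => min (rowMult M i j) (pendingMult M i j)) ∧
      newLabels [] (matrixWord a b M) = rowWord a (fun i => pendingMult M i b) := by
  induction a with
  | zero => simp [matrixWord, residual, newLabels, rowWord, rowMult]
  | succ a ih =>
    obtain ⟨h1, h2, h3⟩ := ih
    obtain ⟨h4, h5⟩ := rowResult_rowWord b (rowMult M a) (M a)
    have h6 : bumped (rowWord b (rowMult M a)) (rowWord b (M a)) =
        rowWord b fun j => min (rowMult M a j) (pendingMult M a j) := by
      rw [bumped, h5, List.reduceOption_append, List.reduceOption_replicate_none,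
        List.append_nil]
      simp [List.reduceOption, pendingMult]
    have h7 : (rowOut (rowWord b (rowMult M a)) (rowWord b (M a))).count none =
        pendingMult M a b := by
      rw [h5, List.count_append, List.count_replicate_self, List.count_eq_zero_of_not_mem]
      · simp [pendingMult]
      · simp
    refine ⟨?_, ?_, ?_⟩
    · rw [matrixWord_succ, List.map_append, rowResult_append, h1, List.map_map]
      simp only [Function.comp_def, List.map_id']
      exact h4
    · rw [matrixWord_succ, residual_append, h1, h2, residual_map_mk, h6, matrixWord_succ]
    · rw [matrixWord_succ, newLabels_append, h1, h3, newLabels_map_mk, h7, rowWord_succ]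

theorem mem_matrixWord {a b : ℕ} {M : ℕ → ℕ → ℕ} {c : ℕ × ℕ} :
    c ∈ matrixWord a b M ↔ c.1 < a ∧ c.2 < b ∧ M c.1 c.2 ≠ 0 := by
  simp only [matrixWord, List.mem_flatMap, List.mem_range, List.mem_map, mem_rowWord]
  constructor
  · rintro ⟨i, hi, j, hj, rfl⟩
    exact ⟨hi, hj⟩
  · rintro ⟨h1, h2⟩
    exact ⟨c.1, h1, c.2, h2, rfl⟩

/-- Transposing M exchanges the first rows of P and Q and transposes the residual matrix of minima,
whose bi-word is shorter; induction on the length of the bi-word. -/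
theorem rsk_matrixWord_swap (a b : ℕ) (M : ℕ → ℕ → ℕ) :
    rsk (matrixWord b a fun j i => M i j) = (rsk (matrixWord a b M)).swap := by
  induction hn : (matrixWord a b M).length using Nat.strong_induction_on generalizing M with
  | _ n ih =>
    by_cases h : matrixWord a b M = []
    · have h' : (matrixWord b a fun j i => M i j) = [] := by
        rw [List.eq_nil_iff_forall_not_mem] at h ⊢
        rintro ⟨j, i⟩ hc
        have := h (i, j)
        simp only [mem_matrixWord] at this hc
        exact this ⟨hc.2.1, hc.1, hc.2.2⟩
      rw [h, h']
      rfl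
    · have h' : (matrixWord b a fun j i => M i j) ≠ [] := by
        obtain ⟨⟨i, j⟩, hc⟩ := List.exists_mem_of_ne_nil _ h
        simp only [mem_matrixWord] at hc
        exact List.ne_nil_of_mem (a := (j, i)) (mem_matrixWord.mpr ⟨hc.2.1, hc.1, hc.2.2⟩)
      obtain ⟨h1, h2, h3⟩ := rowResult_matrixWord a b M
      obtain ⟨h4, h5, h6⟩ := rowResult_matrixWord b a fun j i => M i j
      have hlt := length_residual_lt h
      have hih := ih _ (hn ▸ hlt) (fun i j => min (rowMult M i j) (pendingMult M i j)) (by rw [h2])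
      rw [rsk_eq_cons h, rsk_eq_cons h', h1, h2, h3, h4, h5, h6]
      have e1 : (fun j i => min (rowMult (fun j i => M i j) j i)
          (pendingMult (fun j i => M i j) j i)) =
          fun j i => min (rowMult M i j) (pendingMult M i j) := by
        funext j i
        rw [(rowMult_swap M i j).1, (rowMult_swap M i j).2, min_comm]
      have e2 : rowMult (fun j i => M i j) b = fun i => pendingMult M i b := by
        funext i
        exact (rowMult_swap M i b).1
      have e3 : (fun j => pendingMult (fun j i => M i j) j a) = rowMult M a := by
        funext j
        exact (rowMult_swap M a j).2
      rw [e1, e2, e3, hih]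
      rfl

/-! ### Symmetry for arbitrary ordered alphabets, by relabelling. -/

theorem rowInsert_map {α' : Type*} [LinearOrder α'] {g : α → α'} (hg : StrictMono g) (x : α)
    (r : List α) : rowInsert (g x) (r.map g) =
      ((rowInsert x r).1.map g, (rowInsert x r).2.map g) := by
  induction r with
  | nil => rfl
  | cons y r ih =>
    rcases lt_or_ge x y with h | h
    · simp [rowInsert_cons_of_lt h, rowInsert_cons_of_lt (hg h)]
    · simp [rowInsert_cons_of_le h, rowInsert_cons_of_le (hg.monotone h), ih]

theorem bump_map {α' : Type*} [LinearOrder α'] {g : α → α'} (hg : StrictMono g)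
    (T : Tableau α) (x : α) :
    bump (T.map (List.map g)) (g x) = ((bump T x).1.map (List.map g), (bump T x).2) := by
  induction T generalizing x with
  | nil => rfl
  | cons r T ih =>
    rcases h : rowInsert x r with ⟨r', _ | y⟩ <;> simp [bump, rowInsert_map hg, h, ih]

theorem addBox_map {β β' : Type*} (f : β → β') (i : β) (k : ℕ) (T : Tableau β) :
    addBox (f i) k (T.map (List.map f)) = (addBox i k T).map (List.map f) := by
  induction T generalizing k with
  | nil => simp [addBox]
  | cons r T ih => cases k <;> simp [addBox, ih]

theorem rsk_map {α' β' : Type*} [LinearOrder α'] {g : α → α'}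
    (hg : StrictMono g) (f : β → β') (w : List (β × α)) :
    rsk (w.map (Prod.map f g)) =
      ((rsk w).1.map (List.map g), (rsk w).2.map (List.map f)) := by
  induction w using List.reverseRecOn with
  | nil => rfl
  | append_singleton w c ih =>
    simp [rsk_append, ih, bump_map hg, addBox_map]

section Lex

variable [LinearOrder β]

/-- The columns of the bi-word are in lexicographic order. -/
def LexSorted (w : List (β × α)) : Prop :=
  w.Pairwise fun c d => c.1 < d.1 ∨ c.1 = d.1 ∧ c.2 ≤ d.2

theorem LexSorted.eq_of_perm {u v : List (β × α)} (hu : LexSorted u) (hv : LexSorted v)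
    (h : u.Perm v) : u = v := by
  refine h.eq_of_pairwise (fun c d _ _ h1 h2 => ?_) hu hv
  rcases h1 with h1 | ⟨h1, h1'⟩ <;> rcases h2 with h2 | ⟨h2, h2'⟩
  · exact absurd h1 (lt_asymm h2)
  · exact absurd h1 (h2 ▸ lt_irrefl _)
  · exact absurd h2 (h1 ▸ lt_irrefl _)
  · exact Prod.ext h1 (le_antisymm h1' h2')

theorem rowWord_sorted (b : ℕ) (m : ℕ → ℕ) : (rowWord b m).Pairwise (· ≤ ·) := by
  induction b with
  | zero => simp [rowWord]
  | succ b ih =>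
    rw [rowWord_succ, List.pairwise_append]
    refine ⟨ih, List.pairwise_replicate.mpr (Or.inr le_rfl), fun x hx y hy => ?_⟩
    rw [List.eq_of_mem_replicate hy]
    exact (mem_rowWord.mp hx).1.le

theorem matrixWord_lexSorted (a b : ℕ) (M : ℕ → ℕ → ℕ) : LexSorted (matrixWord a b M) := by
  induction a with
  | zero => simp [LexSorted, matrixWord]
  | succ a ih =>
    rw [matrixWord_succ, LexSorted, List.pairwise_append]
    refine ⟨ih, ?_, fun x hx y hy => ?_⟩
    · rw [List.pairwise_map]
      exact (rowWord_sorted b _).imp fun h => Or.inr ⟨rfl, h⟩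
    · obtain ⟨j, _, rfl⟩ := List.mem_map.mp hy
      exact Or.inl (mem_matrixWord.mp hx).1

theorem count_rowWord (b : ℕ) (m : ℕ → ℕ) (j : ℕ) :
    (rowWord b m).count j = if j < b then m j else 0 := by
  induction b with
  | zero => simp [rowWord]
  | succ b ih =>
    rw [rowWord_succ, List.count_append, ih, List.count_replicate]
    rcases lt_trichotomy j b with h | rfl | h
    · simp [h, h.ne', Nat.lt_succ_of_lt h]
    · simp
    · simp [not_lt.mpr h.le, h.ne, not_lt.mpr (Nat.succ_le_of_lt h)]

theorem count_matrixWord (a b : ℕ) (M : ℕ → ℕ → ℕ) (c : ℕ × ℕ) :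
    (matrixWord a b M).count c = if c.1 < a ∧ c.2 < b then M c.1 c.2 else 0 := by
  induction a with
  | zero => simp [matrixWord]
  | succ a ih =>
    obtain ⟨i, j⟩ := c
    rw [matrixWord_succ, List.count_append, ih]
    rcases eq_or_ne i a with rfl | h
    · rw [List.count_map_of_injective _ _ (Prod.mk_right_injective i), count_rowWord]
      simp
    · rw [List.count_eq_zero_of_not_mem (a := (i, j)) (l := List.map _ _) (by simp [h.symm])]
      have : i < a + 1 ↔ i < a := by omega
      simp [this]

theorem LexSorted.map {α' β' : Type*} [LinearOrder α'] [LinearOrder β'] {g : α → α'}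
    (hg : StrictMono g) {f : β → β'} (hf : StrictMono f) {w : List (β × α)} :
    LexSorted (w.map (Prod.map f g)) ↔ LexSorted w := by
  simp [LexSorted, List.pairwise_map, hf.lt_iff_lt, hf.injective.eq_iff, hg.le_iff_le]

theorem rsk_swap_nat {w w' : List (ℕ × ℕ)} (hw : LexSorted w) (hw' : LexSorted w')
    (h : w'.Perm (w.map Prod.swap)) : rsk w' = (rsk w).swap := by
  obtain ⟨N, hN⟩ : ∃ N, ∀ c ∈ w, c.1 < N ∧ c.2 < N := by
    clear hw h
    induction w with
    | nil => exact ⟨0, by simp⟩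
    | cons c w ih =>
      obtain ⟨N, hN⟩ := ih
      refine ⟨max N (max (c.1 + 1) (c.2 + 1)), fun d hd => ?_⟩
      rcases List.mem_cons.mp hd with rfl | hd
      · omega
      · have := hN d hd
        omega
  have e : w = matrixWord N N fun i j => w.count (i, j) := by
    refine hw.eq_of_perm (matrixWord_lexSorted _ _ _) (List.perm_iff_count.mpr fun c => ?_)
    rw [count_matrixWord]
    split_ifs with hc
    · rfl
    · exact List.count_eq_zero_of_not_mem fun hm => hc (hN c hm)
  have e' : w' = matrixWord N N fun j i => w.count (i, j) := by
    refine hw'.eq_of_perm (matrixWord_lexSorted _ _ _) (List.perm_iff_count.mpr fun c => ?_)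
    rw [count_matrixWord, h.count_eq, ← Prod.swap_swap c,
      List.count_map_of_injective _ _ Prod.swap_injective, Prod.swap_swap]
    split_ifs with hc
    · rfl
    · exact List.count_eq_zero_of_not_mem fun hm => hc (hN _ hm).symm
  rw [e', rsk_matrixWord_swap, ← e]

theorem exists_map_of_forall_mem_range {γ δ : Type*} (f : γ → δ) (w : List δ)
    (h : ∀ x ∈ w, x ∈ Set.range f) : ∃ v : List γ, v.map f = w := by
  have : w ∈ Set.range (List.map f) := by rw [Set.range_list_map]; exact h
  exact this

/-- Interchanging the two rows of a bi-word interchanges its `P`-symbol and its `Q`-symbol. -/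
theorem rsk_swap {w : List (β × α)} {w' : List (α × β)} (hw : LexSorted w) (hw' : LexSorted w')
    (h : w'.Perm (w.map Prod.swap)) : rsk w' = (rsk w).swap := by
  -- Letters are replaced by their ranks among the finitely many that occur, which reduces the claim
  -- to natural numbers.
  let f := (w.map Prod.fst).toFinset.orderEmbOfFin rfl
  let g := (w.map Prod.snd).toFinset.orderEmbOfFin rfl
  obtain ⟨v, hv⟩ := exists_map_of_forall_mem_range (Prod.map f g) w (by
    intro c hc
    rw [Set.range_prodMap, Set.mem_prod, Finset.range_orderEmbOfFin, Finset.range_orderEmbOfFin]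
    simp only [List.coe_toFinset]
    exact ⟨List.mem_map_of_mem hc, List.mem_map_of_mem hc⟩)
  have hp := h
  rw [← hv, List.map_map] at hp
  obtain ⟨v', hv'⟩ := exists_map_of_forall_mem_range (Prod.map g f) w' (by
    intro c hc
    obtain ⟨d, _, rfl⟩ := List.mem_map.mp (hp.subset hc)
    exact ⟨d.swap, rfl⟩)
  have hp : v'.Perm (v.map Prod.swap) := by
    refine (List.map_perm_map_iff (g.injective.prodMap f.injective)).mp ?_
    rw [hv', List.map_map]
    exact hp
  have hn : ∀ k, StrictMono (Fin.val : Fin k → ℕ) := fun k => Fin.val_strictMono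
  rw [← hv, LexSorted.map g.strictMono f.strictMono, ← LexSorted.map (hn _) (hn _)] at hw
  rw [← hv', LexSorted.map f.strictMono g.strictMono, ← LexSorted.map (hn _) (hn _)] at hw'
  have key := rsk_swap_nat hw hw' (by
    rw [List.map_map]
    refine (hp.map _).trans ?_
    rw [List.map_map]
    rfl)
  rw [rsk_map (hn _), rsk_map (hn _), Prod.swap_prod_mk, Prod.mk.injEq] at key
  have hinj : ∀ k, Function.Injective (List.map (List.map (Fin.val : Fin k → ℕ))) := fun k =>
    (Fin.val_injective.list_map).list_map
  rw [← hv, ← hv', rsk_map g.strictMono, rsk_map f.strictMono, hinj _ key.1, hinj _ key.2]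
  rfl

end Lex

end Symmetry

/-! ### Box-labels of places -/

section Places

variable (δ : ℤ → ℕ+)

theorem lastPlace_add_one (j : ℤ) : lastPlace δ (j + 1) = lastPlace δ j + (δ (j + 1) : ℕ) := by
  unfold lastPlace
  rcases le_or_gt 0 j with h | h
  · have e1 : Finset.Ioc 0 (j + 1) = insert (j + 1) (Finset.Ioc 0 j) := by
      ext x
      simp only [Finset.mem_Ioc, Finset.mem_insert]
      omega
    rw [e1, Finset.sum_insert (by simp), Finset.Ioc_eq_empty (by omega : ¬ j + 1 < 0),
      Finset.Ioc_eq_empty (by omega : ¬ j < 0)]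
    ring
  · have e1 : Finset.Ioc j 0 = insert (j + 1) (Finset.Ioc (j + 1) 0) := by
      ext x
      simp only [Finset.mem_Ioc, Finset.mem_insert]
      omega
    rw [e1, Finset.sum_insert (by simp), Finset.Ioc_eq_empty (by omega : ¬ 0 < j + 1),
      Finset.Ioc_eq_empty (by omega : ¬ 0 < j)]
    ring

theorem lastPlace_eq_add (j : ℤ) : lastPlace δ j = lastPlace δ (j - 1) + (δ j : ℕ) := by
  simpa using lastPlace_add_one δ (j - 1)

/-- This is where positive capacities enter: last places advance by at least one per box, so every
place belongs to a box. -/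
theorem lastPlace_sub_monotone : Monotone fun j => lastPlace δ j - j := by
  refine monotone_int_of_le_succ fun j => ?_
  have h1 := lastPlace_add_one δ j
  have h2 := (δ (j + 1)).pos
  change lastPlace δ j - j ≤ lastPlace δ (j + 1) - (j + 1)
  omega

theorem lastPlace_monotone : Monotone (lastPlace δ) := fun i j h => by
  have := lastPlace_sub_monotone δ h
  simp only at this
  omega

theorem boxLabel_le_iff {i j : ℤ} : boxLabel δ i ≤ j ↔ i ≤ lastPlace δ j := by
  have h0 : lastPlace δ 0 = 0 := by simp [lastPlace]
  -- Since `lastPlace δ 0` = 0, the last place of box j is at most j for j ≤ 0 and at least j for j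
  -- ≥ 0; this gives the witnesses min 0 i and max 0 i.
  have hbdd : BddBelow {j : ℤ | i ≤ lastPlace δ j} := by
    refine ⟨min 0 i, fun k hk => ?_⟩
    rw [Set.mem_ofPred_eq] at hk
    rcases le_total k 0 with h | h
    · have := lastPlace_sub_monotone δ h
      simp only at this
      omega
    · omega
  have hne : {j : ℤ | i ≤ lastPlace δ j}.Nonempty := by
    refine ⟨max 0 i, ?_⟩
    have := lastPlace_sub_monotone δ (le_max_left 0 i)
    simp only at this
    rw [Set.mem_ofPred_eq]
    omega
  constructor
  · intro h
    exact (Int.csInf_mem hne hbdd : i ≤ lastPlace δ (boxLabel δ i)).trans (lastPlace_monotone δ h)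
  · intro h
    exact csInf_le hbdd h

theorem boxLabel_eq_iff {i j : ℤ} :
    boxLabel δ i = j ↔ lastPlace δ (j - 1) < i ∧ i ≤ lastPlace δ j := by
  rw [← boxLabel_le_iff, ← not_le, ← boxLabel_le_iff]
  omega

theorem boxLabel_lastPlace (j : ℤ) : boxLabel δ (lastPlace δ j) = j := by
  rw [boxLabel_eq_iff]
  have := lastPlace_eq_add δ j
  have := (δ j).pos
  omega

theorem boxLabel_monotone : Monotone (boxLabel δ) := fun i i' h => by
  rw [boxLabel_le_iff]
  exact h.trans ((boxLabel_le_iff δ).mp le_rfl)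

theorem count_boxLabel_le (p q j : ℤ) :
    ((Finset.Icc p q).val.map (boxLabel δ)).count j ≤ δ j := by
  rw [Multiset.count_map, ← Finset.filter_val, Finset.card_val]
  have h : Finset.filter (fun i => j = boxLabel δ i) (Finset.Icc p q) ⊆
      Finset.Ioc (lastPlace δ (j - 1)) (lastPlace δ j) := by
    intro i hi
    rw [Finset.mem_Ioc]
    exact (boxLabel_eq_iff δ).mp (Finset.mem_filter.mp hi).2.symm
  have h2 := Finset.card_le_card h
  rw [Int.card_Ioc, lastPlace_eq_add] at h2
  omega

theorem count_boxLabel_eq {p q j : ℤ} (hp : boxLabel δ p < j) (hq : j < boxLabel δ q) :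
    ((Finset.Icc p q).val.map (boxLabel δ)).count j = δ j := by
  refine le_antisymm (count_boxLabel_le δ p q j) ?_
  rw [Multiset.count_map, ← Finset.filter_val, Finset.card_val]
  have hp' : p ≤ lastPlace δ (j - 1) := (boxLabel_le_iff δ).mp (by omega)
  have hq' : lastPlace δ j < q := by
    by_contra h
    exact absurd ((boxLabel_le_iff δ).mpr (not_lt.mp h)) (not_le.mpr hq)
  have h : Finset.Ioc (lastPlace δ (j - 1)) (lastPlace δ j) ⊆
      Finset.filter (fun i => j = boxLabel δ i) (Finset.Icc p q) := by
    intro i hi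
    rw [Finset.mem_Ioc] at hi
    rw [Finset.mem_filter, Finset.mem_Icc]
    exact ⟨⟨by omega, by omega⟩, ((boxLabel_eq_iff δ).mpr hi).symm⟩
  have h2 := Finset.card_le_card h
  rw [Int.card_Ioc, lastPlace_eq_add] at h2
  omega

theorem le_countP_boxLabel {p q j : ℤ} {N : ℕ} (hp : p ≤ lastPlace δ j)
    (hq : lastPlace δ j + N ≤ q) :
    N ≤ ((Finset.Icc p q).val.map (boxLabel δ)).countP (j < ·) := by
  rw [Multiset.countP_map, ← Finset.filter_val, Finset.card_val]
  have h : Finset.Ioc (lastPlace δ j) (lastPlace δ j + N) ⊆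
      Finset.filter (fun i => j < boxLabel δ i) (Finset.Icc p q) := by
    intro i hi
    rw [Finset.mem_Ioc] at hi
    rw [Finset.mem_filter, Finset.mem_Icc, ← not_le, boxLabel_le_iff]
    omega
  simpa using Finset.card_le_card h

end Places

/-! ### Words of a state -/

section Words

variable {α β : Type*} [LinearOrder α] [LinearOrder β]

theorem count_flatMap_replicate {l : List α} (hl : l.Nodup) (m : α → ℕ) (j : α) :
    (l.flatMap fun i => List.replicate (m i) i).count j = if j ∈ l then m j else 0 := by
  induction l with
  | nil => simp
  | cons i l ih =>
    rw [List.nodup_cons] at hl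
    rw [List.flatMap_cons, List.count_append, ih hl.2, List.count_replicate]
    rcases eq_or_ne i j with rfl | h
    · simp [hl.1]
    · simp [h, h.symm]

theorem count_flatMap_map_mk {l : List β} (hl : l.Nodup) (g : β → List α) (c : β × α) :
    (l.flatMap fun i => (g i).map (i, ·)).count c =
      if c.1 ∈ l then (g c.1).count c.2 else 0 := by
  obtain ⟨b, a⟩ := c
  induction l with
  | nil => simp
  | cons i l ih =>
    rw [List.nodup_cons] at hl
    rw [List.flatMap_cons, List.count_append, ih hl.2]
    rcases eq_or_ne i b with rfl | h
    · rw [List.count_map_of_injective _ _ (Prod.mk_right_injective i)]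
      simp [hl.1]
    · rw [List.count_eq_zero_of_not_mem (by simp [h])]
      simp [h.symm]

theorem lexSorted_flatMap {l : List β} (hl : l.Pairwise (· < ·)) {g : β → List α}
    (hg : ∀ i ∈ l, (g i).Pairwise (· ≤ ·)) :
    LexSorted (l.flatMap fun i => (g i).map (i, ·)) := by
  induction l with
  | nil => simp [LexSorted]
  | cons i l ih =>
    rw [List.pairwise_cons] at hl
    rw [List.flatMap_cons, LexSorted, List.pairwise_append]
    refine ⟨?_, ih hl.2 fun j hj => hg j (by simp [hj]), fun x hx y hy => ?_⟩
    · rw [List.pairwise_map]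
      exact (hg i (by simp)).imp fun h => Or.inr ⟨rfl, h⟩
    · obtain ⟨_, _, rfl⟩ := List.mem_map.mp hx
      obtain ⟨j, hj, hy⟩ := List.mem_flatMap.mp hy
      obtain ⟨_, _, rfl⟩ := List.mem_map.mp hy
      exact Or.inl (hl.1 j hj)

end Words

namespace State

variable {δ : ℤ → ℕ+} {n : ℕ}

theorem mem_nonemptyBoxes {s : State δ n} {j : ℤ} : j ∈ s.nonemptyBoxes ↔ s.content j ≠ 0 := by
  simp [nonemptyBoxes]

theorem count_positions (s : State δ n) (k : Fin n) (j : ℤ) :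
    (s.positions k).count j = (s.content j).count k := by
  rw [positions, count_flatMap_replicate (Finset.sort_nodup _ _)]
  simp only [Finset.mem_sort, mem_nonemptyBoxes]
  split_ifs with h
  · rfl
  · rw [not_not.mp h, Multiset.count_zero]

theorem positions_sorted (s : State δ n) (k : Fin n) :
    (s.positions k).Pairwise (· ≤ ·) := by
  have : ∀ l : List ℤ, l.Pairwise (· ≤ ·) →
      (l.flatMap fun i => List.replicate ((s.content i).count k) i).Pairwise (· ≤ ·) := by
    intro l hl
    induction l with
    | nil => simp
    | cons i l ih =>
      rw [List.pairwise_cons] at hl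
      rw [List.flatMap_cons, List.pairwise_append]
      refine ⟨List.pairwise_replicate.mpr (Or.inr le_rfl), ih hl.2, fun x hx y hy => ?_⟩
      obtain ⟨j, hj, hy⟩ := List.mem_flatMap.mp hy
      rw [List.eq_of_mem_replicate hx, List.eq_of_mem_replicate hy]
      exact hl.1 j hj
  exact this _ (Finset.pairwise_sort _ _)

theorem eq_positions {s : State δ n} {k : Fin n} {l : List ℤ} (hl : l.Pairwise (· ≤ ·))
    (h : ∀ j, (s.content j).count k = l.count j) : s.positions k = l :=
  List.Perm.eq_of_pairwise' (s.positions_sorted k) hl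
    (List.perm_iff_count.mpr fun j => by rw [count_positions, h])

/-- The columns (ball-color, box-label) of a state in lexicographic order. -/
noncomputable def colorWord (s : State δ n) : List (Fin n × ℤ) :=
  (List.finRange n).flatMap fun k => (s.positions k).map (k, ·)

/-- The box-labels of the balls, arranged by the colors. -/
noncomputable def boxWord (s : State δ n) : List ℤ := (List.finRange n).flatMap s.positions

theorem map_snd_colorWord (s : State δ n) : s.colorWord.map Prod.snd = s.boxWord := by
  simp [colorWord, boxWord, List.map_flatMap, Function.comp_def]

theorem colorWord_perm (s : State δ n) : s.colorWord.Perm (s.biword.map Prod.swap) := by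
  rw [List.perm_iff_count]
  rintro ⟨k, j⟩
  rw [colorWord, count_flatMap_map_mk (List.nodup_finRange n), biword,
    show (k, j) = Prod.swap (j, k) from rfl, List.count_map_of_injective _ _ Prod.swap_injective,
    count_flatMap_map_mk (Finset.sort_nodup _ _)]
  simp only [Finset.mem_sort, mem_nonemptyBoxes, Prod.swap_prod_mk, List.mem_finRange, if_true,
    count_positions]
  split_ifs with h
  · rw [← Multiset.coe_count, Multiset.sort_eq]
  · rw [not_not.mp h, Multiset.count_zero]

theorem rsk_colorWord (s : State δ n) : rsk s.colorWord = (rsk s.biword).swap := by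
  refine rsk_swap ?_ ?_ s.colorWord_perm
  · exact lexSorted_flatMap (Finset.sortedLT_sort _).pairwise
      fun i _ => Multiset.pairwise_sort _ _
  · exact lexSorted_flatMap (List.sortedLT_finRange n).pairwise fun k _ => s.positions_sorted k

/-- By the symmetry, Q becomes an insertion tableau of the word on which the dynamics acts. -/
theorem qSymbol_eq (s : State δ n) : s.qSymbol = insertWord [] s.boxWord := by
  rw [← map_snd_colorWord, ← rsk_fst, rsk_colorWord]
  rfl

theorem pSymbol_eq (s : State δ n) : s.pSymbol = (rsk s.colorWord).2 := by
  rw [rsk_colorWord]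
  rfl

theorem length_boxWord (s : State δ n) : s.boxWord.length = s.numBalls := by
  rw [← map_snd_colorWord, List.length_map, s.colorWord_perm.length_eq, List.length_map, biword,
    List.length_flatMap, numBalls, Finset.sum_eq_multiset_sum,
    ← Finset.sort_eq s.nonemptyBoxes (· ≤ ·), Multiset.map_coe, Multiset.sum_coe]
  simp

theorem count_boxWord (s : State δ n) (j : ℤ) : s.boxWord.count j = (s.content j).card := by
  rw [boxWord, List.count_flatMap]
  have : (List.count j ∘ s.positions) = fun k => (s.content j).count k := by
    funext k
    exact s.count_positions k j
  rw [this, ← List.ofFn_eq_map, List.sum_ofFn]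
  exact Multiset.sum_count_eq_card fun a _ => Finset.mem_univ a

theorem mem_boxWord {s : State δ n} {j : ℤ} : j ∈ s.boxWord ↔ s.content j ≠ 0 := by
  rw [← List.count_pos_iff, count_boxWord, Multiset.card_pos]

/-! ### Time evolution and the carrier algorithm -/

/-- The carrier `C` holds all the vacancies of the boxes between `a` and `b`, and some of the
vacancies of the box `b`. -/
structure IsCarrier (s : State δ n) (a b : ℤ) (C : List ℤ) : Prop where
  sorted : C.Pairwise (· ≤ ·)
  le : ∀ c ∈ C, c ≤ b
  count_eq : ∀ j, a < j → j < b → C.count j + (s.content j).card = δ j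
  count_le : a < b → C.count b + (s.content b).card ≤ δ b

/-- Boxes strictly between a and b whose label is absent from the carrier are full, so the smallest
label of C beyond i is the nearest box with a vacancy. -/
theorem IsCarrier.nearestRight {s : State δ n} {a b i : ℤ} {C : List ℤ} (h : s.IsCarrier a b C)
    (hi : a ≤ i) (hx : ∃ c ∈ C, i < c) : s.nearestRight i = unload C i := by
  obtain ⟨h1, h2, h3⟩ := unload_spec h.sorted hx
  have hu := h.le _ h1
  refine IsLeast.csInf_eq ⟨⟨h2, ?_⟩, ?_⟩
  · have hc := List.count_pos_iff.mpr h1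
    rcases hu.lt_or_eq with hb | hb
    · have := h.count_eq _ (hi.trans_lt h2) hb
      omega
    · have := h.count_le (hi.trans_lt (h2.trans_le hu))
      rw [hb] at hc ⊢
      omega
  · rintro j ⟨hj, hj'⟩
    by_contra hlt
    rw [not_le] at hlt
    have hc : C.count j = 0 := List.count_eq_zero_of_not_mem fun hm =>
      absurd (h3 j hm hj) (not_le.mpr hlt)
    have := h.count_eq j (hi.trans_lt hj) (hlt.trans_le hu)
    omega

theorem count_reload {C : List ℤ} (hC : C.Pairwise (· ≤ ·)) {i : ℤ} (hx : ∃ c ∈ C, i < c)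
    (j : ℤ) : (reload C i).count j + (if unload C i = j then 1 else 0) =
      C.count j + (if i = j then 1 else 0) := by
  have h := rowInsert_perm i C
  rw [rowInsert_eq_reload hC hx] at h
  have := h.count_eq j
  simpa [List.count_cons] using this

theorem card_content_moveBall {s : State δ n} {k : Fin n} {i : ℤ} (hk : k ∈ s.content i) (j : ℤ) :
    ((s.moveBall k i).content j).card + (if i = j then 1 else 0) =
      (s.content j).card + (if s.nearestRight i = j then 1 else 0) := by
  have hlt := (s.nearestRight_mem i).1
  simp only [moveBall]
  rcases eq_or_ne j i with rfl | h1
  · simp [hlt.ne', Multiset.card_erase_add_one hk]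
  · rcases eq_or_ne j (s.nearestRight i) with rfl | h2
    · simp [hlt.ne, hlt.ne']
    · simp [h1, h1.symm, h2, h2.symm]

theorem count_content_moveBall {s : State δ n} {k : Fin n} {i : ℤ} (hk : k ∈ s.content i)
    (j : ℤ) :
    ((s.moveBall k i).content j).count k + (if i = j then 1 else 0) =
      (s.content j).count k + (if s.nearestRight i = j then 1 else 0) := by
  have hlt := (s.nearestRight_mem i).1
  simp only [moveBall]
  rcases eq_or_ne j i with rfl | h1
  · have := Multiset.count_pos.mpr hk
    simp [hlt.ne']
    omega
  · rcases eq_or_ne j (s.nearestRight i) with rfl | h2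
    · simp [hlt.ne, hlt.ne']
    · simp [h1, h1.symm, h2, h2.symm]

theorem count_content_moveBall_of_ne (s : State δ n) {k k' : Fin n} (h : k' ≠ k) (i j : ℤ) :
    ((s.moveBall k i).content j).count k' = (s.content j).count k' := by
  simp only [moveBall]
  split_ifs
  · exact Multiset.count_erase_of_ne h _
  · exact Multiset.count_cons_of_ne h _
  · rfl

/-- The ball fills a vacancy in the box `unload C i` and leaves one in box i. Nothing need be
recorded for box a, because balls starting at or beyond a arrive strictly to the right of it. -/
theorem IsCarrier.moveBall {s : State δ n} {a b i : ℤ} {C : List ℤ} (h : s.IsCarrier a b C)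
    (hi : a ≤ i) (hx : ∃ c ∈ C, i < c) {k : Fin n} (hk : k ∈ s.content i) :
    (s.moveBall k i).IsCarrier a b (reload C i) := by
  have hc := count_reload h.sorted hx
  have hm := card_content_moveBall hk
  rw [h.nearestRight hi hx] at hm
  obtain ⟨h1, h2, -⟩ := unload_spec h.sorted hx
  refine ⟨reload_sorted h.sorted i, fun c hc => ?_, fun j hj hj' => ?_, fun hab => ?_⟩
  · rw [reload, List.mem_orderedInsert] at hc
    rcases hc with rfl | hc
    · exact h2.le.trans (h.le _ h1)
    · exact h.le _ (List.mem_of_mem_erase hc)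
  · have := h.count_eq j hj hj'
    have := hc j
    have := hm j
    omega
  · have := h.count_le hab
    have := hc b
    have := hm b
    omega

/-- Balls of one color are indistinguishable, so it suffices that each box holds as many of them as
there are departures still due from it; arrivals only help to preserve this. -/
theorem IsCarrier.foldl_moveBall {s : State δ n} {a b : ℤ} {C w : List ℤ} (h : s.IsCarrier a b C)
    (hl : Loads C w) (ha : ∀ i ∈ w, a ≤ i) {k : Fin n}
    (hk : ∀ j, w.count j ≤ (s.content j).count k) :
    (w.foldl (State.moveBall k) s).IsCarrier a b (carrierAlgorithm C w).1 ∧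
      (∀ k' ≠ k, ∀ j, ((w.foldl (State.moveBall k) s).content j).count k' =
        (s.content j).count k') ∧
      ∀ j, ((w.foldl (State.moveBall k) s).content j).count k + w.count j =
        (s.content j).count k + (carrierWord C w).count j := by
  induction w generalizing s C with
  | nil => exact ⟨h, fun _ _ _ => rfl, fun _ => rfl⟩
  | cons i w ih =>
    have hi := ha i (by simp)
    have hki : k ∈ s.content i := by
      have := hk i
      rw [List.count_cons_self] at this
      exact Multiset.count_pos.mp (by omega)
    have hm := count_content_moveBall hki
    obtain ⟨h1, h2, h3⟩ := ih (h.moveBall hi hl.1 hki) hl.2 (fun j hj => ha j (by simp [hj]))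
      (fun j => by
        have := hk j
        have := hm j
        simp only [List.count_cons, beq_iff_eq] at *
        omega)
    refine ⟨h1, fun k' hk' j => ?_, fun j => ?_⟩
    · rw [List.foldl_cons, h2 k' hk' j, count_content_moveBall_of_ne s hk']
    · have := h3 j
      have := hm j
      rw [h.nearestRight hi hl.1] at this
      simp only [List.foldl_cons, carrierWord_cons, List.count_cons, beq_iff_eq] at *
      omega

/-- The output of a weakly increasing word is weakly increasing, so it is the list of new positions
itself and not just a rearrangement of it. -/
theorem IsCarrier.moveColor {s : State δ n} {a b : ℤ} {C : List ℤ} (h : s.IsCarrier a b C)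
    {k : Fin n} (hl : Loads C (s.positions k)) (ha : ∀ i ∈ s.positions k, a ≤ i) :
    (s.moveColor k).IsCarrier a b (carrierAlgorithm C (s.positions k)).1 ∧
      (∀ k' ≠ k, (s.moveColor k).positions k' = s.positions k') ∧
      (s.moveColor k).positions k = carrierWord C (s.positions k) := by
  obtain ⟨h1, h2, h3⟩ := h.foldl_moveBall hl ha fun j => (s.count_positions k j).le
  refine ⟨h1, fun k' hk' => ?_, ?_⟩
  · refine eq_positions (s.positions_sorted k') fun j => ?_
    rw [count_positions]
    exact h2 k' hk' j
  · refine eq_positions (carrierWord_sorted h.sorted (s.positions_sorted k) hl) fun j => ?_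
    have := h3 j
    rw [count_positions] at this
    exact Nat.add_right_cancel (this.trans (Nat.add_comm _ _))

theorem IsCarrier.foldl_moveColor {s : State δ n} {a b : ℤ} {C : List ℤ} (h : s.IsCarrier a b C)
    {ks : List (Fin n)} (hks : ks.Nodup) (hl : Loads C (ks.flatMap s.positions))
    (ha : ∀ i ∈ ks.flatMap s.positions, a ≤ i) :
    (∀ k ∉ ks, (ks.foldl State.moveColor s).positions k = s.positions k) ∧
      (∀ k, ((ks.foldl State.moveColor s).positions k).length = (s.positions k).length) ∧
      ks.flatMap (ks.foldl State.moveColor s).positions =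
        carrierWord C (ks.flatMap s.positions) := by
  induction ks generalizing s C with
  | nil => exact ⟨fun _ _ => rfl, fun _ => rfl, rfl⟩
  | cons k ks ih =>
    rw [List.nodup_cons] at hks
    rw [List.flatMap_cons, loads_append] at hl
    obtain ⟨h1, h2, h3⟩ := h.moveColor hl.1 fun i hi => ha i (by simp [hi])
    have e : ks.flatMap (s.moveColor k).positions = ks.flatMap s.positions :=
      List.flatMap_congr fun k' hk' => h2 k' fun e => hks.1 (e ▸ hk')
    obtain ⟨g1, g2, g3⟩ := ih h1 hks.2 (e ▸ hl.2)
      (fun i hi => ha i (by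
        rw [List.flatMap_cons, List.mem_append]
        exact Or.inr (e ▸ hi)))
    refine ⟨fun k' hk' => ?_, fun k' => ?_, ?_⟩
    · rw [List.mem_cons, not_or] at hk'
      rw [List.foldl_cons, g1 k' hk'.2, h2 k' hk'.1]
    · rw [List.foldl_cons, g2 k']
      rcases eq_or_ne k' k with rfl | hk
      · rw [h3, length_carrierWord]
      · rw [h2 k' hk]
    · rw [List.foldl_cons, List.flatMap_cons, List.flatMap_cons, g1 k hks.1, g3, h3, e, carrierWord,
        carrierWord, carrierWord, carrierAlgorithm_append]

theorem IsCarrier.evolve {s : State δ n} {a b : ℤ} {C : List ℤ} (h : s.IsCarrier a b C)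
    (hl : Loads C s.boxWord) (ha : ∀ i ∈ s.boxWord, a ≤ i) :
    s.evolve.boxWord = carrierWord C s.boxWord ∧
      ∀ k, (s.evolve.positions k).length = (s.positions k).length := by
  obtain ⟨_, h2, h3⟩ := h.foldl_moveColor (List.nodup_finRange n) hl ha
  exact ⟨h3, h2⟩

end State

/-! ### The initial carrier and the window. -/

theorem loads_of_countP {C w : List ℤ} (hC : C.Pairwise (· ≤ ·)) {m : ℤ} (hw : ∀ x ∈ w, x ≤ m)
    (h : w.length ≤ C.countP (m < ·)) : Loads C w := by
  induction w generalizing C with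
  | nil => trivial
  | cons x w ih =>
    have hx : ∃ c ∈ C, x < c := by
      have hpos : 0 < C.countP (m < ·) := lt_of_lt_of_le (by simp) h
      obtain ⟨c, hc, hmc⟩ := List.countP_pos_iff.mp hpos
      exact ⟨c, hc, (hw x (by simp)).trans_lt (of_decide_eq_true hmc)⟩
    refine ⟨hx, ih (reload_sorted hC x) (fun a ha => hw a (by simp [ha])) ?_⟩
    have hp := rowInsert_perm x C
    rw [rowInsert_eq_reload hC hx] at hp
    have := hp.countP_eq (m < ·)
    simp only [Option.toList_some, List.singleton_append, List.countP_cons,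
      List.length_cons] at this h
    have : (if decide (m < unload C x) = true then 1 else 0) ≤ 1 := by split_ifs <;> simp
    omega

namespace State

variable {δ : ℤ → ℕ+} {n : ℕ}

theorem coe_readingWord_qSymbol (s : State δ n) :
    (readingWord s.qSymbol : Multiset ℤ) = (s.boxWord : Multiset ℤ) := by
  rw [qSymbol_eq]
  exact Multiset.coe_eq_coe.mpr (readingWord_insertWord_perm _)

theorem coe_initialCarrier (s : State δ n) (p q : ℤ) :
    (initialCarrier δ p q s.qSymbol : Multiset ℤ) =
      (Finset.Icc p q).val.map (boxLabel δ) - (s.boxWord : Multiset ℤ) := by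
  rw [initialCarrier, Multiset.sort_eq, coe_readingWord_qSymbol]

theorem isCarrier_initialCarrier (s : State δ n) (p q : ℤ) :
    s.IsCarrier (boxLabel δ p) (boxLabel δ q) (initialCarrier δ p q s.qSymbol) := by
  have hcount : ∀ j, (initialCarrier δ p q s.qSymbol).count j =
      ((Finset.Icc p q).val.map (boxLabel δ)).count j - (s.content j).card := by
    intro j
    rw [← Multiset.coe_count, coe_initialCarrier, Multiset.count_sub, Multiset.coe_count,
      count_boxWord]
  refine ⟨Multiset.pairwise_sort _ _, fun c hc => ?_, fun j hj hj' => ?_, fun _ => ?_⟩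
  · rw [← Multiset.mem_coe, coe_initialCarrier] at hc
    obtain ⟨i, hi, rfl⟩ := Multiset.mem_map.mp (Multiset.mem_of_le tsub_le_self hc)
    exact boxLabel_monotone δ (Finset.mem_Icc.mp hi).2
  · have := s.card_le j
    rw [hcount, count_boxLabel_eq δ hj hj']
    omega
  · have := s.card_le (boxLabel δ q)
    have := count_boxLabel_le δ p q (boxLabel δ q)
    rw [hcount]
    omega

/-- Packing the balls to the right makes the window reach N places beyond the end of the last
nonempty box, all of them in later, empty boxes. -/
theorem occupied_lastPlace {s : State δ n} {j : ℤ} (hj : s.content j ≠ 0) :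
    s.Occupied (lastPlace δ j) := by
  rw [Occupied, boxLabel_lastPlace]
  have := Multiset.card_pos.mpr hj
  omega

theorem Occupied.content_ne_zero {s : State δ n} {i : ℤ} (h : s.Occupied i) :
    s.content (boxLabel δ i) ≠ 0 := by
  intro h0
  rw [Occupied, h0] at h
  have := (boxLabel_le_iff δ (i := i)).mp le_rfl
  simp only [Multiset.card_zero, Nat.cast_zero, sub_zero] at h
  omega

/-- All the balls of the state, and as many vacant places to the right of them, lie between the
places `p` and `q`. -/
def IsWindow (s : State δ n) (p q : ℤ) : Prop :=
  ∀ i : ℤ, s.Occupied i → p ≤ i ∧ i + s.numBalls ≤ q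

theorem IsWindow.mono {s : State δ n} {p q p' q' : ℤ} (h : s.IsWindow p q) (hp : p' ≤ p)
    (hq : q ≤ q') : s.IsWindow p' q' := fun i hi =>
  ⟨hp.trans (h i hi).1, (h i hi).2.trans hq⟩

theorem exists_isWindow (s : State δ n) : ∃ p q, s.IsWindow p q := by
  obtain ⟨a, ha⟩ := s.finite.bddBelow
  obtain ⟨b, hb⟩ := s.finite.bddAbove
  refine ⟨lastPlace δ (a - 1), lastPlace δ b + s.numBalls, fun i hi => ?_⟩
  have h1 := ha hi.content_ne_zero
  have h2 := (boxLabel_le_iff δ).mp (hb hi.content_ne_zero)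
  have h3 : ¬ i ≤ lastPlace δ (a - 1) := by
    rw [← boxLabel_le_iff]
    omega
  omega

theorem IsWindow.loads {s : State δ n} {p q : ℤ} (h : s.IsWindow p q) :
    Loads (initialCarrier δ p q s.qSymbol) s.boxWord := by
  rcases s.nonemptyBoxes.eq_empty_or_nonempty with he | he
  · have : s.boxWord = [] := by
      rw [List.eq_nil_iff_forall_not_mem]
      intro j hj
      rw [mem_boxWord, ← mem_nonemptyBoxes, he] at hj
      simp at hj
    rw [this]
    trivial
  · set m := s.nonemptyBoxes.max' he with hm
    have hw : ∀ x ∈ s.boxWord, x ≤ m := fun x hx =>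
      Finset.le_max' _ _ (mem_nonemptyBoxes.mpr (mem_boxWord.mp hx))
    have hmem : s.content m ≠ 0 := mem_nonemptyBoxes.mp (Finset.max'_mem _ he)
    obtain ⟨h1, h2⟩ := h _ (occupied_lastPlace hmem)
    refine loads_of_countP (Multiset.pairwise_sort _ _) hw ?_
    -- The window contributes at least N labels beyond the last nonempty box m. None of them is
    -- removed with the entries of Q, and each of the N loads uses up at most one.
    have h3 := le_countP_boxLabel δ h1 h2
    have h4 : (Finset.Icc p q).val.map (boxLabel δ) ≤
        (initialCarrier δ p q s.qSymbol : Multiset ℤ) + (s.boxWord : Multiset ℤ) := by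
      rw [coe_initialCarrier]
      exact le_tsub_add
    have h5 := Multiset.countP_le_of_le (m < ·) h4
    have h6 : (s.boxWord : Multiset ℤ).countP (m < ·) = 0 :=
      Multiset.countP_eq_zero.mpr fun x hx => not_lt.mpr (hw x hx)
    rw [Multiset.countP_add, h6, add_zero, Multiset.coe_countP] at h5
    rw [length_boxWord]
    exact h3.trans h5

theorem IsWindow.evolve {s : State δ n} {p q : ℤ} (h : s.IsWindow p q) :
    s.evolve.boxWord = carrierWord (initialCarrier δ p q s.qSymbol) s.boxWord ∧
      ∀ k, (s.evolve.positions k).length = (s.positions k).length := by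
  refine (s.isCarrier_initialCarrier p q).evolve h.loads fun j hj => ?_
  rw [boxLabel_le_iff]
  exact (h _ (occupied_lastPlace (mem_boxWord.mp hj))).1

theorem IsWindow.qSymbol_evolve {s : State δ n} {p q : ℤ} (h : s.IsWindow p q) :
    shape s.evolve.qSymbol = shape s.qSymbol ∧
      readingWord s.evolve.qSymbol =
        carrierWord (initialCarrier δ p q s.qSymbol) (readingWord s.qSymbol) := by
  have key := insertWord_carrierWord (s.isCarrier_initialCarrier p q).sorted h.loads
  rw [← h.evolve.1, ← qSymbol_eq, ← qSymbol_eq] at key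
  exact key

theorem map_fst_colorWord_evolve (s : State δ n) :
    s.evolve.colorWord.map Prod.fst = s.colorWord.map Prod.fst := by
  obtain ⟨p, q, h⟩ := s.exists_isWindow
  simp [colorWord, List.map_flatMap, Function.comp_def, h.evolve.2]

/-- P records the colors along the insertion of `boxWord`. The row of colors is unchanged, and as
the carrier output of a prefix is the prefix of the output, all intermediate shapes are unchanged
too. -/
theorem pSymbol_evolve (s : State δ n) : s.evolve.pSymbol = s.pSymbol := by
  obtain ⟨p, q, h⟩ := s.exists_isWindow
  have hzip : ∀ t : State δ n, t.colorWord = (t.colorWord.map Prod.fst).zip t.boxWord := by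
    intro t
    exact List.zip_of_prod rfl t.map_snd_colorWord
  have hlen : ∀ t : State δ n, t.boxWord.length = (t.colorWord.map Prod.fst).length := by
    intro t
    rw [← map_snd_colorWord, List.length_map, List.length_map]
  rw [pSymbol_eq, pSymbol_eq, hzip s, hzip s.evolve, map_fst_colorWord_evolve]
  refine rsk_snd_congr ?_ (hlen s) fun k => ?_
  · rw [hlen, map_fst_colorWord_evolve]
  · have hl := h.loads
    rw [h.evolve.1]
    set C := initialCarrier δ p q s.qSymbol
    have hC : C.Pairwise (· ≤ ·) := Multiset.pairwise_sort _ _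
    rw [← List.take_append_drop k s.boxWord, loads_append] at hl
    have e : (carrierWord C s.boxWord).take k = carrierWord C (s.boxWord.take k) := by
      conv_lhs => rw [← List.take_append_drop k s.boxWord]
      rw [carrierWord, carrierAlgorithm_append]
      rcases le_total k s.boxWord.length with hk | hk
      · exact List.take_left' (by rw [length_carrierWord, List.length_take, min_eq_left hk])
      · simp only [List.drop_of_length_le hk, carrierWord_nil, List.append_nil]
        exact List.take_of_length_le (by rw [length_carrierWord, List.length_take]; omega)
    rw [e]
    exact (insertWord_carrierWord hC hl.1).1

end State

theorem eq_of_shape_eq_of_readingWord_eq {α : Type*} {T U : Tableau α} (h : shape T = shape U)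
    (h' : readingWord T = readingWord U) : T = U := by
  induction T generalizing U with
  | nil =>
    cases U with
    | nil => rfl
    | cons s U => simp [shape] at h
  | cons r T ih =>
    cases U with
    | nil => simp [shape] at h
    | cons s U =>
      simp only [shape, List.map_cons, List.cons.injEq] at h
      rw [readingWord_cons, readingWord_cons] at h'
      obtain ⟨h1, h2⟩ := List.append_inj' h' h.1
      rw [h2, ih h.2 h1]

/-- Enlarging a window keeps it valid, so both states can use the same p and q and then have the
same initial carrier. -/
theorem State.qSymbol_evolve_congr {δ : ℤ → ℕ+} {n n' : ℕ} {s : State δ n} {t : State δ n'}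
    (h : s.qSymbol = t.qSymbol) : s.evolve.qSymbol = t.evolve.qSymbol := by
  obtain ⟨p, q, hs⟩ := s.exists_isWindow
  obtain ⟨p', q', ht⟩ := t.exists_isWindow
  have hs' := (hs.mono (min_le_left p p') (le_max_left q q')).qSymbol_evolve
  have ht' := (ht.mono (min_le_right p p') (le_max_right q q')).qSymbol_evolve
  refine eq_of_shape_eq_of_readingWord_eq ?_ ?_
  · rw [hs'.1, ht'.1, h]
  · rw [hs'.2, ht'.2, h]

end BoxBall

theorem theorem5p1 (δ : ℤ → ℕ+) :
    -- the `P`-symbol is conserved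
    (∀ (n : ℕ) (s : BoxBall.State δ n), s.evolve.pSymbol = s.pSymbol) ∧
    -- the `Q`-symbol evolves independently of the `P`-symbol
    (∃ F : BoxBall.Tableau ℤ → BoxBall.Tableau ℤ,
      ∀ (n : ℕ) (s : BoxBall.State δ n), s.evolve.qSymbol = F s.qSymbol) ∧
    -- the `Q`-symbol evolves by the box-label algorithm with a carrier, at the level of words
    (∀ (n : ℕ) (s : BoxBall.State δ n) (p q : ℤ),
      (∀ i : ℤ, s.Occupied i → p ≤ i ∧ i + s.numBalls ≤ q) →
      BoxBall.shape s.evolve.qSymbol = BoxBall.shape s.qSymbol ∧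
      BoxBall.readingWord s.evolve.qSymbol =
        (BoxBall.carrierAlgorithm (BoxBall.initialCarrier δ p q s.qSymbol)
          (BoxBall.readingWord s.qSymbol)).2) := by
  classical
  refine ⟨fun n s => s.pSymbol_evolve, ?_, fun n s p q h => BoxBall.State.IsWindow.qSymbol_evolve h⟩
  -- F evolves an arbitrarily chosen state with Q-symbol T; the choice does not matter. The value
  -- `[]` serves only tableaux that are no Q-symbol.
  refine ⟨fun T => if h : ∃ n, ∃ s : BoxBall.State δ n, s.qSymbol = T then
    h.choose_spec.choose.evolve.qSymbol else [], fun n s => ?_⟩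
  have h : ∃ n', ∃ t : BoxBall.State δ n', t.qSymbol = s.qSymbol := ⟨n, s, rfl⟩
  refine Eq.trans ?_ (dif_pos h).symm
  exact (BoxBall.State.qSymbol_evolve_congr h.choose_spec.choose_spec).symm
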